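/- Graphs are finite and loopless, and multiple edges are allowed. An edge is \emph{multiple} if another edge has the same endpoints, and \emph{simple} otherwise; a \emph{bundle} is a maximal set of multiple edges with the same endpoints; a graph is \emph{simple} if all its edges are simple. A subgraph $I$ of $H$ is \emph{semi-induced} if any two vertices of $I$ that are adjacent in $H$ are joined by at least one edge of $I$. A \emph{PI-graph} of $G$ is an induced subgraph of a graph obtained from $G$ by replacing some (possibly none) of its bundles with simple edges. Let $\mathcal C_H$ be the set of all vertices and all multiple edges of $H$. A set $A\subseteq\mathcal C_H$ is \emph{admissible} to a connected graph $H$ if $|A\cap V(H)|$ is even, every vertex of $H$ that is incident only to simple edges of $H$ is in $A$, and $|A\cap B|$ is even and nonzero for each bundle $B$ of $H$; it is admissible to a disconnected graph $H$ if $A\cap\mathcal C_{H'}$ is admissible to each component $H'$ of $H$. For $A$ admissible to $H$, let $\mathcal P^{\mathrm{even}}_{H,A}$ be the set of all semi-induced subgraphs $I$ of $H$ (including $\emptyset$ and $H$) each of whose components contains an even number of elements of $A$, ordered by subgraph containment. A finite poset is \emph{shellable} if the facets of its order complex can be ordered $F_1,\dots,F_t$ so that, for $k=2,\dots,t$, the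 complex $\bigl(\bigcup_{i<k}\overline{F_i}\bigr)\cap\overline{F_k}$ is pure of dimension $\dim F_k-1$, where $\overline{F}$ is the complex of all faces of $F$ (the complexes need not be pure). Let $\mathcal G^*$ be the family of all graphs $G$ such that $\mathcal P^{\mathrm{even}}_{H,A}$ is shellable for every PI-graph $H$ of $G$ and every $A$ admissible to $H$. For $m\ge 2$, define the following graphs on the vertices $0,1,\dots,n-1$, each of which has exactly $m$ edges between $0$ and $1$, all its other edges being simple. - $\tilde P_{n,m}$ ($n\ge2$): the other edges are $\{i,i+1\}$ for $1\le i\le n-2$. - $\tilde S_{n,m}$ ($n\ge5$ odd): the other edges are $\{i,i+1\}$ for $1\le i\le n-3$, and $\{n-3,n-1\}$. - $\tilde T_{n,m}$ ($n\ge5$ odd): $\tilde S_{n,m}$ with the edge $\{n-2,n-1\}$ added. - $\tilde P'_{n,m}$ ($n\ge3$), $\tilde S'_{n,m}$ and $\tilde T'_{n,m}$ ($n\ge5$ odd): the graphs $\tilde P_{n,m}$, $\tilde S_{n,m}$ and $\tilde T_{n,m}$, respectively, with the edge $\{0,2\}$ added. **Theorem.** Every connected non-simple graph in $\mathcal G^*$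 is isomorphic to one of the graphs $\tilde P_{n,m}$ ($n\ge2$), $\tilde P'_{n,m}$ ($n\ge 3$), $\tilde S_{n,m}$, $\tilde T_{n,m}$, $\tilde S'_{n,m}$, $\tilde T'_{n,m}$ ($n\ge5$ odd), for some $m\ge2$. -/

import Mathlib

/-! ### Shellability of simplicial complexes and posets

A simplicial complex is given by its set of faces, the empty face included; the dimension of a face
`F` is `F.card - 1`. -/

namespace Shelling

/-- `F` is a facet (an inclusion-maximal face) of the complex `K`. -/
def IsFacet {ι : Type*} (K : Set (Finset ι)) (F : Finset ι) : Prop :=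
  Maximal (· ∈ K) F

/-- `K` is pure of dimension `c - 1`: it has a face, and all its facets have `c` elements. -/
def IsPureOfCard {ι : Type*} (K : Set (Finset ι)) (c : ℕ) : Prop :=
  K.Nonempty ∧ ∀ F, IsFacet K F → F.card = c

/-- The complex of all the faces of the simplex `F`. -/
def simplex {ι : Type*} (F : Finset ι) : Set (Finset ι) :=
  {σ | σ ⊆ F}

/-- `F 0, …, F (t - 1)` is a (nonpure) shelling of `K`: it lists every facet of `K` exactly once,
and every facet but the first meets the union of the preceding ones in a pure complex of
dimension one less than its own. -/
def IsShelling {ι : Type*} (K : Set (Finset ι)) {t : ℕ} (F : Fin t → Finset ι) : Prop :=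
  Function.Injective F ∧ Set.range F = {σ | IsFacet K σ} ∧
    ∀ k : Fin t, 0 < (k : ℕ) →
      IsPureOfCard ((⋃ i : Fin t, ⋃ _ : i < k, simplex (F i)) ∩ simplex (F k)) ((F k).card - 1)

/-- A simplicial complex is shellable if it has a shelling. -/
def IsShellable {ι : Type*} (K : Set (Finset ι)) : Prop :=
  ∃ (t : ℕ) (F : Fin t → Finset ι), IsShelling K F

/-- The order complex of a poset: its faces are the finite chains. -/
def orderComplex (P : Type*) [PartialOrder P] : Set (Finset P) :=
  {σ | IsChain (· ≤ ·) (σ : Set P)}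

/-- A poset is shellable if its order complex is. -/
def IsShellablePoset (P : Type*) [PartialOrder P] : Prop :=
  IsShellable (orderComplex P)

end Shelling

/-! ### Graphs with multiple edges -/

namespace Graph

/-- The set of edges of `G` with endpoints `x` and `y`. -/
def edgesBetween {α β : Type*} (G : Graph α β) (x y : α) : Set β :=
  {e | G.IsLink e x y}

/-- An edge is multiple if another edge has the same endpoints. -/
def IsMultipleEdge {α β : Type*} (G : Graph α β) (e : β) : Prop :=
  ∃ f, f ≠ e ∧ ∃ x y, G.IsLink e x y ∧ G.IsLink f x y

/-- A bundle: the set of all the edges between two vertices, if there are at least two of them. -/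
def IsBundle {α β : Type*} (G : Graph α β) (B : Set β) : Prop :=
  B.Nontrivial ∧ ∃ x y, B = G.edgesBetween x y

/-- A graph is connected if it has a vertex and any two of its vertices are joined by a walk. -/
def IsConnectedGraph {α β : Type*} (G : Graph α β) : Prop :=
  G.vertexSet.Nonempty ∧
    ∀ x ∈ G.vertexSet, ∀ y ∈ G.vertexSet, Relation.ReflTransGen G.Adj x y

/-- `K` is a connected component of `G`. -/
def IsComponentOf {α β : Type*} (K G : Graph α β) : Prop :=
  K.IsClosedSubgraph G ∧ K.IsConnectedGraph

/-- `I` is a semi-induced subgraph of `H`: it has at least one edge between any two of its vertices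
that are adjacent in `H`. -/
def IsSemiInduced {α β : Type*} (I H : Graph α β) : Prop :=
  I ≤ H ∧ ∀ x ∈ I.vertexSet, ∀ y ∈ I.vertexSet, H.Adj x y → I.Adj x y

/-- `H` is a partial underlying graph of `G`: some bundles of `G` are replaced with simple edges.
The simple edge that replaces a bundle is realized by an edge of that bundle. -/
def IsPartialUnderlying {α β : Type*} (H G : Graph α β) : Prop :=
  H.IsSpanningSubgraph G ∧ ∀ x y, H.edgesBetween x y = G.edgesBetween x y ∨
    (G.IsBundle (G.edgesBetween x y) ∧ ∃ e, H.edgesBetween x y = {e})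

/-- `H` is a partial underlying induced graph of `G`. -/
def IsPIGraph {α β : Type*} (H G : Graph α β) : Prop :=
  ∃ K : Graph α β, K.IsPartialUnderlying G ∧ H.IsInducedSubgraph K

/-- The set `𝒞_H` of all the vertices and all the multiple edges of `H`. -/
def labels {α β : Type*} (H : Graph α β) : Set (α ⊕ β) :=
  Sum.inl '' H.vertexSet ∪ Sum.inr '' {e | H.IsMultipleEdge e}

/-- `A` is admissible to the connected graph `H`. -/
def IsAdmissibleConnected {α β : Type*} (H : Graph α β) (A : Set (α ⊕ β)) : Prop :=
  A ⊆ H.labels ∧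
  Even (A ∩ Sum.inl '' H.vertexSet).ncard ∧
  (∀ x ∈ H.vertexSet, (∀ e, H.Inc e x → ¬ H.IsMultipleEdge e) → Sum.inl x ∈ A) ∧
  ∀ B : Set β, H.IsBundle B →
    (A ∩ Sum.inr '' B).Nonempty ∧ Even (A ∩ Sum.inr '' B).ncard

/-- `A` is admissible to the graph `H`: its part in each component of `H` is admissible to that
component. -/
def IsAdmissible {α β : Type*} (H : Graph α β) (A : Set (α ⊕ β)) : Prop :=
  A ⊆ H.labels ∧ ∀ K : Graph α β, K.IsComponentOf H → K.IsAdmissibleConnected (K.labels ∩ A)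

/-- `I` is `A`-even: each of its components has an even number of vertices and edges in `A`. -/
def IsEvenFor {α β : Type*} (I : Graph α β) (A : Set (α ⊕ β)) : Prop :=
  ∀ K : Graph α β, K.IsComponentOf I →
    Even ((Sum.inl '' K.vertexSet ∪ Sum.inr '' K.edgeSet) ∩ A).ncard

/-- The poset of all the `A`-even semi-induced subgraphs of `H`, ordered by subgraph containment. -/
abbrev EvenPoset {α β : Type*} (H : Graph α β) (A : Set (α ⊕ β)) : Type _ :=
  {I : Graph α β // I.IsSemiInduced H ∧ I.IsEvenFor A}

/-- The family `𝒢*` of graphs `G`: for every PI-graph `H` of `G` and every `A` admissible to `H`,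
the poset of `A`-even semi-induced subgraphs of `H` is shellable. -/
def InGStar {α β : Type*} (G : Graph α β) : Prop :=
  ∀ H : Graph α β, H.IsPIGraph G → ∀ A : Set (α ⊕ β), H.IsAdmissible A →
    Shelling.IsShellablePoset (EvenPoset H A)

/-- Isomorphism of graphs. -/
def Isomorphic {α β α' β' : Type*} (G : Graph α β) (G' : Graph α' β') : Prop :=
  ∃ (f : G.vertexSet ≃ G'.vertexSet) (g : G.edgeSet ≃ G'.edgeSet),
    ∀ (e : G.edgeSet) (x y : G.vertexSet), G.IsLink e x y ↔ G'.IsLink (g e) (f x) (f y)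

/-! ### The six families -/

/-- The graph with vertices `0, …, n - 1`, with `m` edges between `0` and `1`, and one further edge
for each pair of vertices in `S`. -/
def withBundle (n m : ℕ) (S : Set (Sym2 ℕ)) : Graph ℕ (ℕ ⊕ Sym2 ℕ) where
  vertexSet := {v | v < n}
  IsLink e x y := x < n ∧ y < n ∧
    ((∃ i < m, e = Sum.inl i ∧ s(x, y) = s(0, 1)) ∨ (s(x, y) ∈ S ∧ e = Sum.inr s(x, y)))
  isLink_symm := by
    intro e _
    refine ⟨fun x y h => ?_⟩
    rw [Sym2.eq_swap (a := y) (b := x)]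
    exact ⟨h.2.1, h.1, h.2.2⟩
  eq_or_eq_of_isLink_of_isLink := by
    rintro e x y v w ⟨-, -, h⟩ ⟨-, -, h'⟩
    have key : s(x, y) = s(v, w) := by
      rcases h with ⟨i, -, rfl, h⟩ | ⟨-, rfl⟩ <;> rcases h' with ⟨j, -, hj, h'⟩ | ⟨-, h'⟩
      · rw [h, h']
      · cases h'
      · cases hj
      · exact Sum.inr.inj h'
    rcases Sym2.eq_iff.1 key with h | h
    · exact Or.inl h.1
    · exact Or.inr h.1
  left_mem_of_isLink := fun _ _ _ h => h.1

/-- The simple edges of the path `1, 2, …, k`. -/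
def pathEdges (k : ℕ) : Set (Sym2 ℕ) :=
  {p | ∃ i, 1 ≤ i ∧ i + 1 ≤ k ∧ p = s(i, i + 1)}

/-- A path with `n` vertices whose first edge is replaced with a bundle of size `m`. -/
def tildeP (n m : ℕ) : Graph ℕ (ℕ ⊕ Sym2 ℕ) :=
  withBundle n m (pathEdges (n - 1))

/-- The path on `0, …, n - 2` whose first edge is replaced with a bundle of size `m`, with one more
vertex `n - 1` adjacent to the last but one vertex `n - 3` of the path. -/
def tildeS (n m : ℕ) : Graph ℕ (ℕ ⊕ Sym2 ℕ) :=
  withBundle n m (pathEdges (n - 2) ∪ {s(n - 3, n - 1)})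

/-- The graph `tildeS n m` with an edge added between `n - 2` and `n - 1`. -/
def tildeT (n m : ℕ) : Graph ℕ (ℕ ⊕ Sym2 ℕ) :=
  withBundle n m (pathEdges (n - 2) ∪ {s(n - 3, n - 1), s(n - 2, n - 1)})

/-- The graph `tildeP n m` with an edge added between `0` and `2`. -/
def tildeP' (n m : ℕ) : Graph ℕ (ℕ ⊕ Sym2 ℕ) :=
  withBundle n m (pathEdges (n - 1) ∪ {s(0, 2)})

/-- The graph `tildeS n m` with an edge added between `0` and `2`. -/
def tildeS' (n m : ℕ) : Graph ℕ (ℕ ⊕ Sym2 ℕ) :=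
  withBundle n m (pathEdges (n - 2) ∪ {s(n - 3, n - 1)} ∪ {s(0, 2)})

/-- The graph `tildeT n m` with an edge added between `0` and `2`. -/
def tildeT' (n m : ℕ) : Graph ℕ (ℕ ⊕ Sym2 ℕ) :=
  withBundle n m (pathEdges (n - 2) ∪ {s(n - 3, n - 1), s(n - 2, n - 1)} ∪ {s(0, 2)})

end Graph

/-!
Suppose that an open interval of a finite poset splits into two parts, each with a chain of two
elements, such that no element of one part is comparable to an element of the other. Then the poset
is not shellable: among the facets of a shelling through a fixed maximal chain outside the interval,
each one that is long enough is linked to an earlier one by a face that still meets the interval, so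
the first of these facets would have to meet both parts.

In the poset of even subgraphs such an interval arises from two edges `a`, `b` of a bundle between
`x` and `y` and two more labels `p` and `q`. By parity, and since `a` or `b` is present exactly if
both `x` and `y` are, a member strictly inside contains exactly one of `p` and `q`, unless its
labels are `{p, q}` or `{x, y, a, b}`, in which case it is comparable to no other member.

For a graph of `𝒢*` this excludes a second bundle (with `p` and `q` two of its edges), and it
excludes two vertices `p` and `q` attached to an even path that leaves the bundle. So there is just
one bundle, all the other edges at it lead to the same third vertex, and the graph grows from there
as a path. With the bundle between `0` and `1`, this path can only fork at an even vertex, and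
nothing lies beyond a fork. The families differ in whether the path ends in such a fork, whether the
two tips of the fork are adjacent, and whether `0` is adjacent to `2`.
-/

namespace Shelling

section Complex

variable {ι : Type*} {K : Set (Finset ι)}

theorem exists_isFacet_superset (hK : K.Finite) {σ : Finset ι} (hσ : σ ∈ K) :
    ∃ F, σ ⊆ F ∧ IsFacet K F :=
  hK.exists_le_maximal hσ

variable {t : ℕ} {F : Fin t → Finset ι} {C : Finset ι}

theorem IsShelling.isFacet (hF : IsShelling K F) (k : Fin t) : IsFacet K (F k) :=
  hF.2.1.subset (Set.mem_range_self k)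

theorem IsShelling.exists_ssubset (hF : IsShelling K F) {j k : Fin t} (hjk : j < k)
    (hj : C ⊆ F j) (hk : C ⊆ F k) :
    ∃ i < k, ∃ τ, C ⊆ τ ∧ τ ⊂ F i ∧ τ ⊆ F k ∧ τ.card = (F k).card - 1 := by
  set L := (⋃ i : Fin t, ⋃ _ : i < k, simplex (F i)) ∩ simplex (F k)
  have hfin : L.Finite :=
    (F k).powerset.finite_toSet.subset fun σ hσ => Finset.mem_coe.2 (Finset.mem_powerset.2 hσ.2)
  have hC : C ∈ L := ⟨Set.mem_iUnion₂.2 ⟨j, hjk, hj⟩, hk⟩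
  obtain ⟨τ, hCτ, hτ⟩ := exists_isFacet_superset hfin hC
  obtain ⟨i, hik, hτi : τ ⊆ F i⟩ := Set.mem_iUnion₂.1 hτ.1.1
  have hτk : τ ⊆ F k := hτ.1.2
  have hne : τ ≠ F i := by
    rintro rfl
    exact hik.ne (hF.1 ((hF.isFacet i).eq_of_le (hF.isFacet k).1 hτk))
  exact ⟨i, hik, τ, hCτ, hτi.ssubset_of_ne hne, hτk,
    (hF.2.2 k (Nat.zero_le _ |>.trans_lt hjk)).2 τ hτ⟩

theorem IsShelling.exists_mem_first (hF : IsShelling K F) {R : ι → Prop}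
    (hR : ∀ k, C ⊆ F k → ∀ z ∈ F k, ∀ w ∈ F k, z ∉ C → w ∉ C → R z → R w)
    {j : Fin t} (hj : C ⊆ F j) (hmin : ∀ i, C ⊆ F i → j ≤ i)
    (k : Fin t) (hk : C ⊆ F k) (hcard : C.card + 2 ≤ (F k).card)
    (hz : ∃ z ∈ F k, z ∉ C ∧ R z) : ∃ z ∈ F j, z ∉ C ∧ R z := by
  induction k using WellFoundedLT.induction with
  | ind k ih =>
    obtain rfl | hjk := (hmin k hk).eq_or_lt
    · exact hz
    obtain ⟨z, hzk, hzC, hRz⟩ := hz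
    obtain ⟨i, hik, τ, hCτ, hτi, hτk, hτcard⟩ := hF.exists_ssubset hjk hj hk
    obtain ⟨w, hwτ, hwC⟩ : ∃ w ∈ τ, w ∉ C :=
      Finset.exists_mem_notMem_of_card_lt_card (by omega)
    have hRw : R w := hR k hk z hzk w (hτk hwτ) hzC hwC hRz
    have := Finset.card_lt_card hτi
    exact ih i hik (hCτ.trans hτi.1) (by omega) ⟨w, hτi.1 hwτ, hwC, hRw⟩

end Complex

section Poset

variable {P : Type*} [PartialOrder P] {I J : P}

/-- The chains of `P` that avoid the open interval from `I` to `J`. -/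
def outerChains (I J : P) : Set (Finset P) :=
  {σ | IsChain (· ≤ ·) (σ : Set P) ∧ ∀ z ∈ σ, z ≤ I ∨ J ≤ z}

theorem between_of_isFacet_outerChains {C σ : Finset P} (hC : IsFacet (outerChains I J) C)
    (hI : I ∈ C) (hJ : J ∈ C) (hσ : IsChain (· ≤ ·) (σ : Set P)) (hCσ : C ⊆ σ) {z : P}
    (hz : z ∈ σ) (hzC : z ∉ C) : I < z ∧ z < J := by
  classical
  have hout : ¬ (z ≤ I ∨ J ≤ z) := by
    intro h
    have hins : insert z C ∈ outerChains I J := by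
      refine ⟨hσ.mono ?_, Finset.forall_mem_insert .. |>.2 ⟨h, hC.1.2⟩⟩
      exact_mod_cast Finset.insert_subset hz hCσ
    exact hzC (hC.2 hins (Finset.subset_insert _ _) (Finset.mem_insert_self _ _))
  rw [not_or] at hout
  exact ⟨((hσ.total (hCσ hI) hz).resolve_right hout.1).lt_of_not_ge hout.1,
    ((hσ.total hz (hCσ hJ)).resolve_right hout.2).lt_of_not_ge hout.2⟩

theorem exists_isFacet_superset_insert_insert [Finite P] {C : Finset P}
    (hC : C ∈ outerChains I J) {X Y : P} (hX : I < X) (hXY : X < Y) (hY : Y < J) :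
    ∃ σ, IsFacet (orderComplex P) σ ∧ C ⊆ σ ∧ C.card + 2 ≤ σ.card ∧ X ∈ σ ∧ X ∉ C := by
  classical
  have hXC : X ∉ C := fun h =>
    (hC.2 X h).elim (fun h => h.not_gt hX) fun h => h.not_gt (hXY.trans hY)
  have hYC : Y ∉ C := fun h =>
    (hC.2 Y h).elim (fun h => h.not_gt (hX.trans hXY)) fun h => h.not_gt hY
  have hchain : insert X (insert Y C) ∈ orderComplex P := by
    have hYC : IsChain (· ≤ ·) (insert Y (C : Set P)) := hC.1.insert fun b hb _ =>
      (hC.2 b hb).elim (fun h => .inr (h.trans (hX.trans hXY).le)) fun h => .inl (hY.le.trans h)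
    have hXYC : IsChain (· ≤ ·) (insert X (insert Y (C : Set P))) := by
      refine hYC.insert fun b hb _ => ?_
      obtain rfl | hb := hb
      · exact .inl hXY.le
      · exact (hC.2 b hb).elim (fun h => .inr (h.trans hX.le))
          fun h => .inl ((hXY.trans hY).le.trans h)
    simpa only [orderComplex, Set.mem_ofPred_eq, Finset.coe_insert] using hXYC
  obtain ⟨σ, hσ, hσf⟩ := exists_isFacet_superset (Set.toFinite _) hchain
  have hcard := Finset.card_le_card hσ
  rw [Finset.card_insert_of_notMem (by simp [hXC, hXY.ne]),
    Finset.card_insert_of_notMem hYC] at hcard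
  have hCσ : C ⊆ σ := (Finset.subset_insert _ _).trans ((Finset.subset_insert _ _).trans hσ)
  exact ⟨σ, hσf, hCσ, hcard, hσ (Finset.mem_insert_self _ _), hXC⟩

theorem iff_of_isFacet_outerChains {C σ : Finset P} (hC : IsFacet (outerChains I J) C)
    (hI : I ∈ C) (hJ : J ∈ C) (hσ : IsChain (· ≤ ·) (σ : Set P)) (hCσ : C ⊆ σ) {Q : P → Prop}
    (hQ : ∀ X Y, I < X → X < Y → Y < J → (Q X ↔ Q Y)) {z w : P} (hz : z ∈ σ) (hzC : z ∉ C)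
    (hw : w ∈ σ) (hwC : w ∉ C) : Q z ↔ Q w := by
  have hzIJ := between_of_isFacet_outerChains hC hI hJ hσ hCσ hz hzC
  have hwIJ := between_of_isFacet_outerChains hC hI hJ hσ hCσ hw hwC
  obtain rfl | hne := eq_or_ne z w
  · rfl
  obtain h | h := hσ.total hz hw
  · exact hQ z w hzIJ.1 (h.lt_of_ne hne) hwIJ.2
  · exact (hQ w z hwIJ.1 (h.lt_of_ne hne.symm) hzIJ.2).symm

theorem not_isShellablePoset_of_separated [Finite P] (Q : P → Prop)
    (hQ : ∀ X Y, I < X → X < Y → Y < J → (Q X ↔ Q Y))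
    {X₁ Y₁ X₂ Y₂ : P} (hI₁ : I < X₁) (hXY₁ : X₁ < Y₁) (hJ₁ : Y₁ < J) (hQ₁ : Q X₁)
    (hI₂ : I < X₂) (hXY₂ : X₂ < Y₂) (hJ₂ : Y₂ < J) (hQ₂ : ¬ Q X₂) :
    ¬ IsShellablePoset P := by
  classical
  rintro ⟨t, F, hF⟩
  have hIJ : ({I, J} : Finset P) ∈ outerChains I J := by
    constructor
    · simpa using IsChain.pair (r := (· ≤ ·)) (hI₁.trans (hXY₁.trans hJ₁)).le
    · simp
  obtain ⟨C, hIJC, hC⟩ := exists_isFacet_superset (Set.toFinite _) hIJ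
  have hagree : ∀ k, C ⊆ F k → ∀ z ∈ F k, ∀ w ∈ F k, z ∉ C → w ∉ C → (Q z ↔ Q w) :=
    fun k hk z hz w hw hzC hwC => iff_of_isFacet_outerChains hC (hIJC (by simp))
      (hIJC (by simp)) (hF.isFacet k).1 hk hQ hz hzC hw hwC
  have hlong : ∀ {X Y}, I < X → X < Y → Y < J →
      ∃ k, C ⊆ F k ∧ C.card + 2 ≤ (F k).card ∧ X ∈ F k ∧ X ∉ C := by
    intro X Y hX hXY hY
    obtain ⟨σ, hσ, h⟩ := exists_isFacet_superset_insert_insert hC.1 hX hXY hY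
    obtain ⟨k, rfl⟩ := hF.2.1.superset hσ
    exact ⟨k, h⟩
  obtain ⟨k₁, hk₁, hcard₁, hX₁, hXC₁⟩ := hlong hI₁ hXY₁ hJ₁
  obtain ⟨k₂, hk₂, hcard₂, hX₂, hXC₂⟩ := hlong hI₂ hXY₂ hJ₂
  obtain ⟨j, hj, hmin⟩ := (Set.toFinite {k | C ⊆ F k}).exists_minimal ⟨k₁, hk₁⟩
  have hfirst : ∀ i, C ⊆ F i → j ≤ i := fun i hi => le_of_not_gt fun h => (hmin hi h.le).not_gt h
  obtain ⟨z, hz, hzC, hQz⟩ := hF.exists_mem_first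
    (fun k hk z hz w hw hzC hwC => (hagree k hk z hz w hw hzC hwC).1)
    hj hfirst k₁ hk₁ hcard₁ ⟨X₁, hX₁, hXC₁, hQ₁⟩
  obtain ⟨w, hw, hwC, hQw⟩ := hF.exists_mem_first (R := fun z => ¬ Q z)
    (fun k hk z hz w hw hzC hwC => mt (hagree k hk z hz w hw hzC hwC).2)
    hj hfirst k₂ hk₂ hcard₂ ⟨X₂, hX₂, hXC₂, hQ₂⟩
  exact hQw ((hagree j hj z hz w hw hzC hwC).1 hQz)

end Poset

end Shelling

namespace Multigraph

open Graph

section Connectivity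

variable {α β : Type*} {G H I X Y : Graph α β} {A : Set (α ⊕ β)} {W W' : Set α}

/-! ### Connected sets of vertices -/

/-- Any two vertices of `X` are joined by a walk; unlike `Graph.IsConnectedGraph`, this allows the
empty graph. -/
def Preconnected (X : Graph α β) : Prop :=
  ∀ u ∈ X.vertexSet, ∀ v ∈ X.vertexSet, Relation.ReflTransGen X.Adj u v

theorem Preconnected.of_adj (hX : Preconnected X) (hV : Y.vertexSet = X.vertexSet)
    (hadj : ∀ u v, X.Adj u v → Y.Adj u v) : Preconnected Y := by
  intro u hu v hv
  rw [hV] at hu hv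
  exact Relation.ReflTransGen.mono hadj _ _ (hX u hu v hv)

/-- The vertices in `W` induce a connected, or empty, subgraph of `G`. -/
def ConnOn (G : Graph α β) (W : Set α) : Prop :=
  Preconnected (G.induce W)

theorem preconnected_of_connOn_vertexSet (hG : ConnOn G G.vertexSet) : Preconnected G :=
  Preconnected.of_adj hG rfl fun _ _ ⟨e, he⟩ => ⟨e, he.1⟩

theorem connOn_empty (G : Graph α β) : ConnOn G ∅ :=
  fun _ hu => hu.elim

theorem connOn_singleton (G : Graph α β) (x : α) : ConnOn G {x} := by
  rintro u rfl v rfl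
  exact .refl

theorem connOn_pair {x y : α} (h : G.Adj x y) : ConnOn G {x, y} := by
  obtain ⟨e, he⟩ := h
  have hxy : (G.induce {x, y}).IsLink e x y := ⟨he, by simp, by simp⟩
  rintro u (rfl | rfl) v (rfl | rfl)
  · exact .refl
  · exact .single hxy.adj
  · exact .single hxy.symm.adj
  · exact .refl

theorem induce_adj_mono (h : W ⊆ W') {u v : α} (huv : (G.induce W).Adj u v) :
    (G.induce W').Adj u v :=
  huv.imp fun _ he => ⟨he.1, h he.2.1, h he.2.2⟩

theorem ConnOn.union (h : ConnOn G W) (h' : ConnOn G W') {z : α} (hz : z ∈ W) (hz' : z ∈ W') :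
    ConnOn G (W ∪ W') := by
  have left {u v} (hu : u ∈ W) (hv : v ∈ W) :=
    Relation.ReflTransGen.mono (fun _ _ => induce_adj_mono (Set.subset_union_left (t := W')))
      _ _ (h u hu v hv)
  have right {u v} (hu : u ∈ W') (hv : v ∈ W') :=
    Relation.ReflTransGen.mono (fun _ _ => induce_adj_mono (Set.subset_union_right (s := W)))
      _ _ (h' u hu v hv)
  rintro u (hu | hu) v (hv | hv)
  · exact left hu hv
  · exact (left hu hz).trans (right hz' hv)
  · exact (right hu hz').trans (left hz hv)
  · exact right hu hv

theorem ConnOn.insert (h : ConnOn G W) {w z : α} (hw : w ∈ W) (hz : G.Adj w z) :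
    ConnOn G (insert z W) := by
  have hunion := h.union (connOn_pair hz) hw (by simp)
  rwa [Set.union_insert, Set.insert_eq_of_mem (Set.mem_union_left _ hw), Set.union_comm,
    ← Set.insert_eq] at hunion

theorem ConnOn.of_adj (h : ConnOn G W) (hadj : ∀ x ∈ W, ∀ y ∈ W, G.Adj x y → H.Adj x y) :
    ConnOn H W :=
  Preconnected.of_adj h rfl fun u v ⟨e, he⟩ =>
    (hadj u he.2.1 v he.2.2 ⟨e, he.1⟩).imp fun _ hf => ⟨hf, he.2⟩

theorem preconnected_of_isSemiInduced (hX : X.IsSemiInduced H) (h : ConnOn H X.vertexSet) :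
    Preconnected X :=
  Preconnected.of_adj h rfl fun u v ⟨e, he⟩ => hX.2 u he.2.1 v he.2.2 ⟨e, he.1⟩

/-! ### Components and even subgraphs -/

/-- The set of all the vertices and edges of a graph. -/
def parts (X : Graph α β) : Set (α ⊕ β) :=
  Sum.inl '' X.vertexSet ∪ Sum.inr '' X.edgeSet

@[simp] theorem inl_mem_parts {x : α} : Sum.inl x ∈ parts X ↔ x ∈ X.vertexSet := by
  simp [parts]

@[simp] theorem inr_mem_parts {e : β} : Sum.inr e ∈ parts X ↔ e ∈ X.edgeSet := by
  simp [parts]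

theorem parts_mono (h : X ≤ Y) : parts X ⊆ parts Y :=
  Set.union_subset_union (Set.image_mono h.vertexSet_mono) (Set.image_mono h.edgeSet_mono)

theorem finite_parts (hV : X.vertexSet.Finite) (hE : X.edgeSet.Finite) : (parts X).Finite :=
  (hV.image _).union (hE.image _)

/-- The connected component of the vertex `v` in `X`. -/
def component (X : Graph α β) (v : α) : Graph α β :=
  X.induce {w | Relation.ReflTransGen X.Adj v w}

theorem component_isComponentOf {v : α} (hv : v ∈ X.vertexSet) :
    (component X v).IsComponentOf X := by
  have hsub : {w | Relation.ReflTransGen X.Adj v w} ⊆ X.vertexSet := by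
    rintro w (_ | ⟨-, h⟩)
    exacts [hv, h.right_mem]
  have hwalk : ∀ w, Relation.ReflTransGen X.Adj v w →
      Relation.ReflTransGen (component X v).Adj v w := by
    intro w hw
    induction hw with
    | refl => exact .refl
    | tail hvx hxy ih =>
      obtain ⟨e, he⟩ := hxy
      exact ih.tail ⟨e, he, hvx, hvx.tail he.adj⟩
  refine ⟨IsClosedSubgraph.mk' (induce_le hsub) ?_, ⟨v, .refl⟩, ?_⟩
  · rintro e x ⟨y, hxy⟩ (hx : Relation.ReflTransGen X.Adj v x)
    have hlink : (component X v).IsLink e x y := ⟨hxy, hx, hx.tail hxy.adj⟩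
    exact hlink.edge_mem
  · exact fun x hx y hy => (symm (hwalk x hx)).trans (hwalk y hy)

theorem component_eq_of_reflTransGen {u v : α} (h : Relation.ReflTransGen X.Adj u v) :
    component X u = component X v := by
  have hreach : {w | Relation.ReflTransGen X.Adj u w} = {w | Relation.ReflTransGen X.Adj v w} :=
    Set.ext fun _ => ⟨(symm h).trans, h.trans⟩
  rw [component, component, hreach]

theorem exists_vertex_of_mem_parts {z : α ⊕ β} (hz : z ∈ parts X) : ∃ w ∈ X.vertexSet,
    z ∈ parts (component X w) ∧
      ∀ v, z ∈ parts (component X v) → component X v = component X w := by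
  obtain ⟨w, hw, rfl⟩ | ⟨e, he, rfl⟩ := hz
  · exact ⟨w, hw, inl_mem_parts.2 .refl, fun v hv =>
      component_eq_of_reflTransGen (inl_mem_parts.1 hv)⟩
  · obtain ⟨x, y, hxy⟩ := exists_isLink_of_mem_edgeSet he
    have hlink : (component X x).IsLink e x y := ⟨hxy, .refl, .single hxy.adj⟩
    refine ⟨x, hxy.left_mem, inr_mem_parts.2 hlink.edge_mem, fun v hv => ?_⟩
    obtain ⟨x', y', hxy', hx', hy'⟩ := exists_isLink_of_mem_edgeSet (inr_mem_parts.1 hv)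
    obtain rfl | rfl := hxy.left_eq_or_eq hxy'
    · exact component_eq_of_reflTransGen hx'
    · exact component_eq_of_reflTransGen hy'

theorem even_ncard_of_pairwiseDisjoint {γ : Type*} {s : Set γ} (hs : s.Finite)
    {C : Set (Set γ)} (hC : C.PairwiseDisjoint id) (hcover : ∀ z ∈ s, ∃ t ∈ C, z ∈ t)
    (heven : ∀ t ∈ C, Even (t ∩ s).ncard) : Even s.ncard := by
  classical
  choose! block hblockC hblock using hcover
  have hblock_eq : ∀ z ∈ s, ∀ t ∈ C, z ∈ t → block z = t := fun z hz t ht hzt =>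
    hC.elim_set (hblockC z hz) ht z (hblock z hz) hzt
  rw [Set.ncard_eq_toFinset_card _ hs, Finset.card_eq_sum_card_fiberwise (f := block)
    (t := hs.toFinset.image block) fun z hz => Finset.mem_image_of_mem _ hz]
  refine Finset.even_sum _ fun t ht => ?_
  obtain ⟨z₀, hz₀, rfl⟩ := Finset.mem_image.1 ht
  have hz₀ : z₀ ∈ s := by simpa using hz₀
  rw [← Set.ncard_coe_finset]
  convert! heven _ (hblockC z₀ hz₀) using 2
  ext z
  simp only [Finset.coe_filter, Set.Finite.mem_toFinset, Set.mem_ofPred_eq, Set.mem_inter_iff]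
  refine ⟨fun ⟨hz, h⟩ => ⟨h ▸ hblock z hz, hz⟩, fun ⟨h, hz⟩ => ⟨hz, ?_⟩⟩
  exact hblock_eq z hz _ (hblockC z₀ hz₀) h

theorem even_ncard_of_isEvenFor (hfin : (parts X ∩ A).Finite) (h : X.IsEvenFor A) :
    Even (parts X ∩ A).ncard := by
  refine even_ncard_of_pairwiseDisjoint hfin
    (C := (fun v => parts (component X v)) '' X.vertexSet) ?_ ?_ ?_
  · rintro _ ⟨u, -, rfl⟩ _ ⟨v, hv, rfl⟩ hne
    refine Set.disjoint_left.2 fun z hu hv' => hne ?_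
    obtain ⟨w, -, -, hw⟩ :=
      exists_vertex_of_mem_parts (parts_mono (component_isComponentOf hv).1.le hv')
    simp only [hw u hu, hw v hv']
  · intro z hz
    obtain ⟨w, hw, hzw, -⟩ := exists_vertex_of_mem_parts hz.1
    exact ⟨_, Set.mem_image_of_mem _ hw, hzw⟩
  · rintro _ ⟨v, hv, rfl⟩
    have hcomponent : parts (component X v) ∩ (parts X ∩ A) = parts (component X v) ∩ A := by
      rw [← Set.inter_assoc,
        Set.inter_eq_left.2 (parts_mono (component_isComponentOf hv).1.le)]
    rw [hcomponent]
    exact h _ (component_isComponentOf hv)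

theorem eq_of_isComponentOf_of_preconnected {K : Graph α β} (hK : K.IsComponentOf X)
    (hX : Preconnected X) : K = X := by
  obtain ⟨u, hu⟩ := hK.2.1
  refine hK.1.isInducedSubgraph.ext_of_vertexSet
    (Set.Subset.antisymm hK.1.vertexSet_mono fun v hv => ?_)
  have hwalk := hX u (hK.1.vertexSet_mono hu) v hv
  induction hwalk with
  | refl => exact hu
  | tail _ hxy ih => exact (hK.1.mem_iff_of_adj hxy).1 (ih hxy.left_mem)

theorem isEvenFor_of_preconnected (hX : Preconnected X) (h : Even (parts X ∩ A).ncard) :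
    X.IsEvenFor A := by
  intro K hK
  rw [eq_of_isComponentOf_of_preconnected hK hX]
  exact h

theorem isAdmissible_of_preconnected (hH : Preconnected H) (hA : H.IsAdmissibleConnected A) :
    H.IsAdmissible A := by
  refine ⟨hA.1, fun K hK => ?_⟩
  rw [eq_of_isComponentOf_of_preconnected hK hH, Set.inter_eq_right.2 hA.1]
  exact hA

theorem finite_evenPoset (hV : H.vertexSet.Finite) (hE : H.edgeSet.Finite)
    (A : Set (α ⊕ β)) : Finite (EvenPoset H A) := by
  have := hV.finite_subsets.to_subtype
  have := hE.finite_subsets.to_subtype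
  refine Finite.of_injective (β := {s | s ⊆ H.vertexSet} × {s | s ⊆ H.edgeSet})
    (fun X => (⟨X.1.vertexSet, X.2.1.1.vertexSet_mono⟩, ⟨X.1.edgeSet, X.2.1.1.edgeSet_mono⟩)) ?_
  intro X Y h
  simp only [Prod.mk.injEq, Subtype.mk.injEq] at h
  exact Subtype.ext ((Compatible.of_le_le X.2.1.1 Y.2.1.1).ext h.1 h.2)

end Connectivity

section BundleInterval

variable {α β : Type*} {H I J X Y : Graph α β} {x y : α} {a b : β} {p q : α ⊕ β}

/-! ### An interval governed by the parity of six labels -/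

theorem even_ncard_inter_insert {γ : Type*} {T s : Set γ} (hs : s.Finite) {c : γ} (hc : c ∉ s) :
    Even (T ∩ insert c s).ncard ↔ (Even (T ∩ s).ncard ↔ c ∉ T) := by
  by_cases hcT : c ∈ T
  · rw [Set.inter_insert_of_mem hcT, Set.ncard_insert_of_notMem (fun h => hc h.2)
      (hs.inter_of_right T), Nat.even_add_one]
    tauto
  · rw [Set.inter_insert_of_notMem hcT]
    tauto

/-- The labels outside the bottom of the interval: the ends `x` and `y` of a bundle, two of its
edges `a` and `b`, and two more labels `p` and `q`. -/
def bundleLabels (x y : α) (a b : β) (p q : α ⊕ β) : Set (α ⊕ β) :=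
  {.inl x, .inl y, .inr a, .inr b, p, q}

/-- The ends of the interval from `I` to `J` in the poset of semi-induced subgraphs of `H` are
recognized by the labels in `bundleLabels x y a b p q`: only `I` contains none of them, and only `J`
contains all of them. -/
structure IsBundleInterval (H I J : Graph α β) (x y : α) (a b : β) (p q : α ⊕ β) : Prop where
  nodup : [.inl x, .inl y, .inr a, .inr b, p, q].Nodup
  isLink_left : H.IsLink a x y
  isLink_right : H.IsLink b x y
  bot_isSemiInduced : I.IsSemiInduced H
  bot_preconnected : Preconnected I
  top_isSemiInduced : J.IsSemiInduced H
  top_preconnected : Preconnected J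
  disjoint_bot : Disjoint (parts I) (bundleLabels x y a b p q)
  subset_top : bundleLabels x y a b p q ⊆ parts J
  eq_or_eq_of_isLink : ∀ e ∈ J.edgeSet, H.IsLink e x y → e = a ∨ e = b
  eq_bot : ∀ X : Graph α β, X.IsSemiInduced H → I ≤ X → X ≤ J →
    Disjoint (parts X) (bundleLabels x y a b p q) → X = I
  eq_top : ∀ X : Graph α β, X.IsSemiInduced H → I ≤ X → X ≤ J →
    bundleLabels x y a b p q ⊆ parts X → X = J

/-- A chain of length two in the open interval from `I` to `J` whose members contain exactly one
of `p` and `q`, namely `ℓ`. -/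
def HasBundleChain (H I J : Graph α β) (x y : α) (a b : β) (p q ℓ : α ⊕ β) : Prop :=
  ∃ s : α ⊕ β, (s = .inl x ∨ s = .inl y) ∧ ∃ X Y : Graph α β, X.IsSemiInduced H ∧
    Y.IsSemiInduced H ∧ Preconnected X ∧ Preconnected Y ∧ I ≤ X ∧ X ≤ Y ∧ Y ≤ J ∧
    parts X ∩ bundleLabels x y a b p q = {s, ℓ} ∧
    parts Y ∩ bundleLabels x y a b p q = {.inl x, .inl y, .inr a, ℓ}

theorem finite_bundleLabels : (bundleLabels x y a b p q).Finite := by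
  simp [bundleLabels]

theorem ncard_bundleLabels (hnodup : [.inl x, .inl y, .inr a, .inr b, p, q].Nodup) :
    (bundleLabels x y a b p q).ncard = 6 := by
  classical
  have hlist : bundleLabels x y a b p q =
      ([.inl x, .inl y, .inr a, .inr b, p, q] : List (α ⊕ β)).toFinset := by
    ext z
    simp [bundleLabels]
  rw [hlist, Set.ncard_coe_finset, List.toFinset_card_of_nodup hnodup]
  rfl

/- Among the labels, `S` and `T` each contain an odd number of `x`, `y`, `a`, `b`, hence exactly one
of `p` and `q`, unless one of them contains just `p` and `q` or all but `p` and `q`; then `S` and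
`T` contain the same labels. -/
theorem mem_and_notMem_iff_of_even {γ : Type*} {S T : Set γ} {x y a b p q : γ}
    (hnodup : [x, y, a, b, p, q].Nodup) (hST : S ⊆ T)
    (hS : Even (S ∩ {x, y, a, b, p, q}).ncard) (hT : Even (T ∩ {x, y, a, b, p, q}).ncard)
    (hSbundle : a ∈ S ∨ b ∈ S ↔ x ∈ S ∧ y ∈ S) (hTbundle : a ∈ T ∨ b ∈ T ↔ x ∈ T ∧ y ∈ T)
    (hSne : ¬ Disjoint S {x, y, a, b, p, q}) (hTne : ¬ {x, y, a, b, p, q} ⊆ T) :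
    (p ∈ S ∧ q ∉ S) ↔ (p ∈ T ∧ q ∉ T) := by
  have parity : ∀ U : Set γ, Even (U ∩ {x, y, a, b, p, q}).ncard ↔
      ((((((q ∉ U) ↔ p ∉ U) ↔ b ∉ U) ↔ a ∉ U) ↔ y ∉ U) ↔ x ∉ U) := by
    intro U
    simp only [List.nodup_cons, List.mem_cons, List.not_mem_nil, or_false] at hnodup
    rw [even_ncard_inter_insert (by simp) (by simpa using hnodup.1),
      even_ncard_inter_insert (by simp) (by simpa using hnodup.2.1),
      even_ncard_inter_insert (by simp) (by simpa using hnodup.2.2.1),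
      even_ncard_inter_insert (by simp) (by simpa using hnodup.2.2.2.1),
      even_ncard_inter_insert (by simp) (by simpa using hnodup.2.2.2.2.1),
      ← insert_empty_eq, even_ncard_inter_insert (by simp) (by simp)]
    simp
  rw [parity] at hS hT
  simp only [Set.disjoint_insert_right, Set.disjoint_singleton_right] at hSne
  simp only [Set.insert_subset_iff, Set.singleton_subset_iff] at hTne
  have hx := @hST x
  have hy := @hST y
  have ha := @hST a
  have hb := @hST b
  have hp := @hST p
  have hq := @hST q
  clear parity hST
  grind

theorem exists_mem_iff_of_isSemiInduced (hX : X.IsSemiInduced H) (ha : H.IsLink a x y)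
    (hb : H.IsLink b x y) (hab : ∀ e ∈ X.edgeSet, H.IsLink e x y → e = a ∨ e = b) :
    a ∈ X.edgeSet ∨ b ∈ X.edgeSet ↔ x ∈ X.vertexSet ∧ y ∈ X.vertexSet := by
  have ends {e : β} (he : H.IsLink e x y) (heX : e ∈ X.edgeSet) :
      x ∈ X.vertexSet ∧ y ∈ X.vertexSet :=
    have heX := (hX.1.isLink_iff heX).2 he
    ⟨heX.left_mem, heX.right_mem⟩
  refine ⟨fun h => h.elim (ends ha) (ends hb), fun ⟨hx, hy⟩ => ?_⟩
  obtain ⟨e, he⟩ := hX.2 x hx y hy ha.adj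
  obtain rfl | rfl := hab e he.edge_mem (he.mono hX.1)
  exacts [.inl he.edge_mem, .inr he.edge_mem]

namespace IsBundleInterval

variable (h : IsBundleInterval H I J x y a b p q) {S : Set α}

include h

theorem even_ncard_iff (hS : S ⊆ I.vertexSet) (hSfin : S.Finite) (hSeven : Even S.ncard)
    (hX : I ≤ X) : Even (parts X ∩ (.inl '' S ∪ bundleLabels x y a b p q)).ncard ↔
      Even (parts X ∩ bundleLabels x y a b p q).ncard := by
  have hSI : Sum.inl '' S ⊆ parts I := (Set.image_mono hS).trans Set.subset_union_left
  rw [Set.inter_union_distrib_left, Set.inter_eq_right.2 (hSI.trans (parts_mono hX)),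
    Set.ncard_union_eq ((h.disjoint_bot.mono_left hSI).mono_right Set.inter_subset_right)
      (hSfin.image _) (finite_bundleLabels.inter_of_right _),
    Set.ncard_image_of_injective _ Sum.inl_injective, Nat.even_add]
  exact iff_true_left hSeven

theorem mem_and_notMem_iff (hX : X.IsSemiInduced H) (hY : Y.IsSemiInduced H) (hIX : I < X)
    (hXY : X ≤ Y) (hYJ : Y < J) (hXeven : Even (parts X ∩ bundleLabels x y a b p q).ncard)
    (hYeven : Even (parts Y ∩ bundleLabels x y a b p q).ncard) :
    (p ∈ parts X ∧ q ∉ parts X) ↔ (p ∈ parts Y ∧ q ∉ parts Y) := by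
  have bundle {Z : Graph α β} (hZ : Z.IsSemiInduced H) (hZJ : Z ≤ J) :
      Sum.inr a ∈ parts Z ∨ Sum.inr b ∈ parts Z ↔ Sum.inl x ∈ parts Z ∧ Sum.inl y ∈ parts Z := by
    simpa only [inl_mem_parts, inr_mem_parts] using
      exists_mem_iff_of_isSemiInduced hZ h.isLink_left h.isLink_right
        fun e he => h.eq_or_eq_of_isLink e (hZJ.edgeSet_mono he)
  exact mem_and_notMem_iff_of_even h.nodup (parts_mono hXY) hXeven hYeven
    (bundle hX (hXY.trans hYJ.le)) (bundle hY hYJ.le)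
    (fun hdisj => hIX.ne' (h.eq_bot X hX hIX.le (hXY.trans hYJ.le) hdisj))
    (fun hsub => hYJ.ne (h.eq_top Y hY (hIX.le.trans hXY) hYJ.le hsub))

theorem exists_chain (hS : S ⊆ I.vertexSet) (hSfin : S.Finite) (hSeven : Even S.ncard)
    {ℓ : α ⊕ β} (hℓ : ℓ = p ∨ ℓ = q) (hchain : HasBundleChain H I J x y a b p q ℓ) :
    ∃ X Y : EvenPoset H (.inl '' S ∪ bundleLabels x y a b p q),
      I < X.1 ∧ X.1 < Y.1 ∧ Y.1 < J ∧ ∀ m, m = p ∨ m = q → (m ∈ parts X.1 ↔ m = ℓ) := by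
  obtain ⟨s, hs, X, Y, hX, hY, hXc, hYc, hIX, hXY, hYJ, hXD, hYD⟩ := hchain
  have hnodup := h.nodup
  simp only [List.nodup_cons, List.mem_cons, List.not_mem_nil, or_false] at hnodup
  have mem_X {m} (hm : m ∈ bundleLabels x y a b p q) : m ∈ parts X ↔ m = s ∨ m = ℓ := by
    simpa [hm] using Set.ext_iff.1 hXD m
  have mem_Y {m} (hm : m ∈ bundleLabels x y a b p q) :
      m ∈ parts Y ↔ m = .inl x ∨ m = .inl y ∨ m = .inr a ∨ m = ℓ := by
    simpa [hm] using Set.ext_iff.1 hYD m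
  have hXeven : Even ({s, ℓ} : Set (α ⊕ β)).ncard := by
    rw [Set.ncard_pair (by grind)]
    exact even_two
  have hYeven : Even ({.inl x, .inl y, .inr a, ℓ} : Set (α ⊕ β)).ncard := by
    rw [Set.ncard_insert_of_notMem (by grind), Set.ncard_insert_of_notMem (by grind),
      Set.ncard_pair (by grind)]
    exact ⟨2, rfl⟩
  refine ⟨⟨X, hX, isEvenFor_of_preconnected hXc ?_⟩, ⟨Y, hY, isEvenFor_of_preconnected hYc ?_⟩,
    hIX.lt_of_ne ?_, hXY.lt_of_ne ?_, hYJ.lt_of_ne ?_, fun m hm => ?_⟩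
  · rwa [h.even_ncard_iff hS hSfin hSeven hIX, hXD]
  · rwa [h.even_ncard_iff hS hSfin hSeven (hIX.trans hXY), hYD]
  · rintro rfl
    exact Set.disjoint_left.1 h.disjoint_bot (hXD.superset (Set.mem_insert _ _)).1
      (hXD.superset (Set.mem_insert _ _)).2
  · rintro rfl
    have := (mem_Y (m := .inr a) (by simp [bundleLabels])).2 (by simp)
    rw [mem_X (by simp [bundleLabels])] at this
    grind
  · rintro rfl
    have := h.subset_top (show .inr b ∈ bundleLabels x y a b p q by simp [bundleLabels])
    rw [mem_Y (by simp [bundleLabels])] at this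
    grind
  · rw [mem_X (by obtain rfl | rfl := hm <;> simp [bundleLabels])]
    grind

theorem not_isShellablePoset (hV : H.vertexSet.Finite) (hE : H.edgeSet.Finite)
    (hS : S ⊆ I.vertexSet) (hSeven : Even S.ncard)
    (hp : HasBundleChain H I J x y a b p q p) (hq : HasBundleChain H I J x y a b p q q) :
    ¬ Shelling.IsShellablePoset (EvenPoset H (.inl '' S ∪ bundleLabels x y a b p q)) := by
  have hSfin : S.Finite := hV.subset (hS.trans h.bot_isSemiInduced.1.vertexSet_mono)
  have heven {Z : Graph α β} (hIZ : I ≤ Z) := h.even_ncard_iff hS hSfin hSeven hIZ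
  obtain ⟨X₁, Y₁, hI₁, hXY₁, hJ₁, hX₁⟩ := h.exists_chain hS hSfin hSeven (.inl rfl) hp
  obtain ⟨X₂, Y₂, hI₂, hXY₂, hJ₂, hX₂⟩ := h.exists_chain hS hSfin hSeven (.inr rfl) hq
  have hpq : p ≠ q := by
    rintro rfl
    simpa using h.nodup
  have hIeven : Even (parts I ∩ bundleLabels x y a b p q).ncard := by
    rw [h.disjoint_bot.inter_eq, Set.ncard_empty]
    exact Even.zero
  have hJeven : Even (parts J ∩ bundleLabels x y a b p q).ncard := by
    rw [Set.inter_eq_right.2 h.subset_top, ncard_bundleLabels h.nodup]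
    exact ⟨3, rfl⟩
  rw [← heven le_rfl] at hIeven
  rw [← heven (hI₁.trans (hXY₁.trans hJ₁)).le] at hJeven
  have := finite_evenPoset hV hE (.inl '' S ∪ bundleLabels x y a b p q)
  refine Shelling.not_isShellablePoset_of_separated
    (I := ⟨I, h.bot_isSemiInduced, isEvenFor_of_preconnected h.bot_preconnected hIeven⟩)
    (J := ⟨J, h.top_isSemiInduced, isEvenFor_of_preconnected h.top_preconnected hJeven⟩)
    (fun Z => p ∈ parts Z.1 ∧ q ∉ parts Z.1) ?_ hI₁ hXY₁ hJ₁ ?_ hI₂ hXY₂ hJ₂ ?_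
  · rintro ⟨X, hX, hXeven⟩ ⟨Y, hY, hYeven⟩ (hIX : I < X) (hXY : X < Y) (hYJ : Y < J)
    have even_parts {Z : Graph α β} (hZ : Z.IsSemiInduced H) (hIZ : I ≤ Z)
        (hZeven : Z.IsEvenFor _) := (heven hIZ).1 <| even_ncard_of_isEvenFor
      ((finite_parts (hV.subset hZ.1.vertexSet_mono) (hE.subset hZ.1.edgeSet_mono)).inter_of_left
        _) hZeven
    exact h.mem_and_notMem_iff hX hY hIX hXY.le hYJ (even_parts hX hIX.le hXeven)
      (even_parts hY (hIX.trans hXY).le hYeven)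
  · simp [hX₁, hpq.symm]
  · simp [hX₂, hpq]

end IsBundleInterval

end BundleInterval

section Trim

variable {α β : Type*} {H X Y : Graph α β} {W W' C : Set α} {M M' : Set β}

/-! ### Semi-induced subgraphs with prescribed multiple edges -/

/-- The subgraph of `H` induced by `W`, with all the multiple edges of `H` outside `M` deleted. -/
def trim (H : Graph α β) (W : Set α) (M : Set β) : Graph α β :=
  (H.induce W).restrict {e | H.IsMultipleEdge e → e ∈ M}

@[simp] theorem vertexSet_trim : (trim H W M).vertexSet = W := rfl

theorem trim_isLink {e : β} {x y : α} : (trim H W M).IsLink e x y ↔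
    H.IsLink e x y ∧ x ∈ W ∧ y ∈ W ∧ (H.IsMultipleEdge e → e ∈ M) := by
  simp only [trim, restrict, Graph.induce, Set.mem_ofPred_eq]
  tauto

theorem mem_edgeSet_trim {e : β} {x y : α} (he : H.IsLink e x y) (hmult : H.IsMultipleEdge e) :
    e ∈ (trim H W M).edgeSet ↔ x ∈ W ∧ y ∈ W ∧ e ∈ M := by
  constructor
  · intro h
    obtain ⟨u, v, huv⟩ := exists_isLink_of_mem_edgeSet h
    rw [trim_isLink] at huv
    obtain ⟨rfl, rfl⟩ | ⟨rfl, rfl⟩ := huv.1.eq_and_eq_or_eq_and_eq he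
    · exact ⟨huv.2.1, huv.2.2.1, huv.2.2.2 hmult⟩
    · exact ⟨huv.2.2.1, huv.2.1, huv.2.2.2 hmult⟩
  · exact fun ⟨hx, hy, heM⟩ => (trim_isLink.2 ⟨he, hx, hy, fun _ => heM⟩).edge_mem

theorem mem_of_mem_edgeSet_trim {e : β} (he : e ∈ (trim H W M).edgeSet)
    (hmult : H.IsMultipleEdge e) : e ∈ M := by
  obtain ⟨u, v, huv⟩ := exists_isLink_of_mem_edgeSet he
  exact (trim_isLink.1 huv).2.2.2 hmult

theorem trim_le (hW : W ⊆ H.vertexSet) : trim H W M ≤ H :=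
  ⟨hW, fun _ _ _ h => (trim_isLink.1 h).1⟩

theorem trim_mono (hW : W ⊆ W') (hM : M ⊆ M') : trim H W M ≤ trim H W' M' :=
  ⟨hW, fun _ _ _ h => by
    rw [trim_isLink] at h ⊢
    exact ⟨h.1, hW h.2.1, hW h.2.2.1, fun h' => hM (h.2.2.2 h')⟩⟩

theorem trim_isSemiInduced (hW : W ⊆ H.vertexSet)
    (hM : ∀ e, H.IsMultipleEdge e → ∃ x y, H.IsLink e x y ∧
      (x ∈ W → y ∈ W → ∃ f ∈ M, H.IsLink f x y)) :
    (trim H W M).IsSemiInduced H := by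
  refine ⟨trim_le hW, ?_⟩
  rintro u hu v hv ⟨e, he⟩
  by_cases hmult : H.IsMultipleEdge e
  · obtain ⟨x, y, hxy, hf⟩ := hM e hmult
    obtain ⟨rfl, rfl⟩ | ⟨rfl, rfl⟩ := hxy.eq_and_eq_or_eq_and_eq he
    · obtain ⟨f, hfM, hf⟩ := hf hu hv
      exact ⟨f, trim_isLink.2 ⟨hf, hu, hv, fun _ => hfM⟩⟩
    · obtain ⟨f, hfM, hf⟩ := hf hv hu
      exact ⟨f, trim_isLink.2 ⟨hf.symm, hu, hv, fun _ => hfM⟩⟩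
  · exact ⟨e, trim_isLink.2 ⟨he, hu, hv, fun h => (hmult h).elim⟩⟩

theorem eq_of_isSemiInduced_of_le (hX : X.IsSemiInduced H) (hYH : Y ≤ H) (hXY : X ≤ Y)
    (hV : Y.vertexSet ⊆ X.vertexSet)
    (hE : ∀ e ∈ Y.edgeSet, H.IsMultipleEdge e → e ∈ X.edgeSet) : X = Y := by
  refine hXY.compatible.ext (hXY.vertexSet_mono.antisymm hV) (hXY.edgeSet_mono.antisymm ?_)
  intro e he
  by_cases hmult : H.IsMultipleEdge e
  · exact hE e he hmult
  obtain ⟨x, y, hxy⟩ := exists_isLink_of_mem_edgeSet he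
  obtain ⟨f, hf⟩ := hX.2 x (hV hxy.left_mem) y (hV hxy.right_mem) (hxy.mono hYH).adj
  obtain rfl | hfe := eq_or_ne f e
  · exact hf.edge_mem
  · exact (hmult ⟨f, hfe, x, y, hxy.mono hYH, hf.mono hX.1⟩).elim

theorem edgesBetween_eq_of_isLink {e : β} {x y u v : α} (hxy : H.IsLink e x y)
    (huv : H.IsLink e u v) : H.edgesBetween u v = H.edgesBetween x y := by
  obtain ⟨rfl, rfl⟩ | ⟨rfl, rfl⟩ := hxy.eq_and_eq_or_eq_and_eq huv
  · rfl
  · exact Set.ext fun _ => isLink_comm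

theorem isAdmissibleConnected_of_edgesBetween (hW : W ⊆ H.vertexSet) (hWeven : Even W.ncard)
    (hM : ∀ e ∈ M, H.IsMultipleEdge e)
    (hsimple : ∀ x ∈ H.vertexSet, x ∉ W → ∃ e, H.Inc e x ∧ H.IsMultipleEdge e)
    (hbundle : ∀ e, H.IsMultipleEdge e → ∃ x y, H.IsLink e x y ∧
      (M ∩ H.edgesBetween x y).Nonempty ∧ Even (M ∩ H.edgesBetween x y).ncard) :
    H.IsAdmissibleConnected (.inl '' W ∪ .inr '' M) := by
  have hinl : (.inl '' W ∪ .inr '' M) ∩ .inl '' H.vertexSet = (.inl '' W : Set (α ⊕ β)) := by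
    ext (z | z)
    · simpa using @hW z
    · simp
  have hinr (B : Set β) : (.inl '' W ∪ .inr '' M) ∩ .inr '' B =
      (.inr '' (M ∩ B) : Set (α ⊕ β)) := by
    ext (z | z) <;> simp
  refine ⟨Set.union_subset_union (Set.image_mono hW) (Set.image_mono hM), ?_, ?_, ?_⟩
  · rwa [hinl, Set.ncard_image_of_injective _ Sum.inl_injective]
  · intro x hx hsimple_x
    by_contra hxA
    obtain ⟨e, he, hmult⟩ := hsimple x hx (by simpa using hxA)
    exact hsimple_x e he hmult
  · rintro B ⟨⟨e, he, f, hf, hef⟩, u, v, rfl⟩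
    obtain ⟨x, y, hxy, hne, heven⟩ := hbundle e ⟨f, hef.symm, u, v, he, hf⟩
    rw [hinr, edgesBetween_eq_of_isLink hxy he, Set.ncard_image_of_injective _ Sum.inr_injective]
    exact ⟨hne.image _, heven⟩

end Trim

section Branching

variable {α β : Type*} {G H I J X : Graph α β} {C : Set α} {x y q r : α} {a b : β}

/-! ### First obstruction: a bundle and two branches -/

/-- The edges `a` and `b` of a bundle join `x` and `y`, and each of the vertices `q` and `r`
together with `x` or with `y` can be attached to the connected even set `C` of other vertices. -/
structure IsBranching (G : Graph α β) (C : Set α) (x y q r : α) (a b : β) : Prop where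
  subset : C ∪ {x, y, q, r} ⊆ G.vertexSet
  nodup : [x, y, q, r].Nodup
  disjoint : Disjoint C {x, y, q, r}
  ne : a ≠ b
  isLink_left : G.IsLink a x y
  isLink_right : G.IsLink b x y
  even : Even C.ncard
  connOn : ConnOn G C
  connOn_left : ConnOn G (C ∪ {x, q}) ∨ ConnOn G (C ∪ {y, q})
  connOn_right : ConnOn G (C ∪ {x, r}) ∨ ConnOn G (C ∪ {y, r})

theorem bundleLabels_swap (p p' : α ⊕ β) :
    bundleLabels x y a b p p' = bundleLabels x y a b p' p := by
  simp only [bundleLabels, Set.pair_comm p p']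

theorem HasBundleChain.swap {p p' ℓ : α ⊕ β} (h : HasBundleChain H I J x y a b p p' ℓ) :
    HasBundleChain H I J x y a b p' p ℓ := by
  simpa only [HasBundleChain, bundleLabels_swap p' p] using h

namespace IsBranching

theorem swap (h : IsBranching G C x y q r a b) : IsBranching G C x y r q a b where
  subset := Set.pair_comm q r ▸ h.subset
  nodup := by
    have := h.nodup
    simp only [List.nodup_cons, List.mem_cons, List.not_mem_nil, or_false] at this ⊢
    tauto
  disjoint := Set.pair_comm q r ▸ h.disjoint
  ne := h.ne
  isLink_left := h.isLink_left
  isLink_right := h.isLink_right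
  even := h.even
  connOn := h.connOn
  connOn_left := h.connOn_right
  connOn_right := h.connOn_left

theorem isMultipleEdge (h : IsBranching G C x y q r a b) :
    G.IsMultipleEdge a ∧ G.IsMultipleEdge b :=
  ⟨⟨b, h.ne.symm, x, y, h.isLink_left, h.isLink_right⟩,
    ⟨a, h.ne, x, y, h.isLink_right, h.isLink_left⟩⟩

theorem connOn_insert_pair (h : IsBranching G C x y q r a b) : ConnOn G (C ∪ {x, y, q}) := by
  have hxy := h.isLink_left.adj
  obtain hconn | hconn := h.connOn_left
  · convert! hconn.insert (w := x) (by simp) hxy using 1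
    grind
  · convert! hconn.insert (w := y) (by simp) hxy.symm using 1
    grind

theorem connOn_union (h : IsBranching G C x y q r a b) : ConnOn G (C ∪ {x, y, q, r}) := by
  convert! h.connOn_insert_pair.union h.swap.connOn_insert_pair (z := x) (by simp) (by simp) using 1
  grind

theorem even_ncard_union (h : IsBranching G C x y q r a b) (hC : C.Finite) :
    Even (C ∪ {x, y, q, r}).ncard := by
  have hnodup := h.nodup
  simp only [List.nodup_cons, List.mem_cons, List.not_mem_nil, or_false] at hnodup
  rw [Set.ncard_union_eq h.disjoint hC (by simp), Set.ncard_insert_of_notMem (by simpa using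
    hnodup.1), Set.ncard_insert_of_notMem (by simpa using hnodup.2.1),
    Set.ncard_pair (by simpa using hnodup.2.2.1)]
  exact h.even.add ⟨2, rfl⟩

variable (h : IsBranching H C x y q r a b)
  (hmult : ∀ e, H.IsMultipleEdge e → H.IsLink e x y)

include h hmult

theorem trim_isSemiInduced {W : Set α} {M : Set β} (hW : W ⊆ C ∪ {x, y, q, r})
    (hM : x ∈ W → y ∈ W → a ∈ M) : (trim H W M).IsSemiInduced H :=
  Multigraph.trim_isSemiInduced (hW.trans h.subset) fun e he =>
    ⟨x, y, hmult e he, fun hx hy => ⟨a, hM hx hy, h.isLink_left⟩⟩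

theorem hasBundleChain : HasBundleChain H (trim H C ∅) (trim H (C ∪ {x, y, q, r}) {a, b}) x y a b
    (.inl q) (.inl r) (.inl q) := by
  obtain ⟨s, hs, hconn⟩ : ∃ s, (s = x ∨ s = y) ∧ ConnOn H (C ∪ {s, q}) :=
    h.connOn_left.elim (fun hconn => ⟨x, .inl rfl, hconn⟩) fun hconn => ⟨y, .inr rfl, hconn⟩
  have hnodup := h.nodup
  have hdisj := h.disjoint
  have hab := h.ne
  simp only [List.nodup_cons, List.mem_cons, List.not_mem_nil, or_false] at hnodup
  simp only [Set.disjoint_insert_right, Set.disjoint_singleton_right] at hdisj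
  have hX := h.trim_isSemiInduced hmult (W := C ∪ {s, q}) (M := {a}) (by grind) (by simp)
  have hY := h.trim_isSemiInduced hmult (W := C ∪ {x, y, q}) (M := {a}) (by grind) (by simp)
  have mem_a {W} := mem_edgeSet_trim (W := W) (M := {a}) h.isLink_left h.isMultipleEdge.1
  have mem_b {W} := mem_edgeSet_trim (W := W) (M := {a}) h.isLink_right h.isMultipleEdge.2
  refine ⟨.inl s, hs.imp (congrArg _) (congrArg _), _, _, hX, hY,
    preconnected_of_isSemiInduced hX hconn, preconnected_of_isSemiInduced hY h.connOn_insert_pair,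
    trim_mono (by grind) (by simp), trim_mono (by grind) subset_rfl,
    trim_mono (by grind) (by simp), ?_, ?_⟩
  · ext (z | e) <;> simp only [bundleLabels, Set.mem_inter_iff, Set.mem_insert_iff,
      Set.mem_singleton_iff, inl_mem_parts, inr_mem_parts, Sum.inl.injEq, Sum.inr.injEq,
      reduceCtorEq, vertexSet_trim] <;> grind
  · ext (z | e) <;> simp only [bundleLabels, Set.mem_inter_iff, Set.mem_insert_iff,
      Set.mem_singleton_iff, inl_mem_parts, inr_mem_parts, Sum.inl.injEq, Sum.inr.injEq,
      reduceCtorEq, vertexSet_trim] <;> grind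

theorem eq_bot (hX : X.IsSemiInduced H) (hIX : trim H C ∅ ≤ X)
    (hXJ : X ≤ trim H (C ∪ {x, y, q, r}) {a, b})
    (hXD : Disjoint (parts X) (bundleLabels x y a b (.inl q) (.inl r))) : X = trim H C ∅ := by
  simp only [bundleLabels, Set.disjoint_insert_right, Set.disjoint_singleton_right,
    inl_mem_parts, inr_mem_parts] at hXD
  have hI := h.trim_isSemiInduced hmult (W := C) (M := ∅) Set.subset_union_left
    fun hx => (Set.disjoint_left.1 h.disjoint hx (by simp)).elim
  refine (eq_of_isSemiInduced_of_le hI hX.1 hIX (fun z hz => ?_) fun e he hemult => ?_).symm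
  · have := hXJ.vertexSet_mono hz
    simp only [vertexSet_trim] at this ⊢
    grind
  · have := mem_of_mem_edgeSet_trim (hXJ.edgeSet_mono he) hemult
    grind

omit hmult in
theorem eq_top (hX : X.IsSemiInduced H) (hIX : trim H C ∅ ≤ X)
    (hXJ : X ≤ trim H (C ∪ {x, y, q, r}) {a, b})
    (hXD : bundleLabels x y a b (.inl q) (.inl r) ⊆ parts X) :
    X = trim H (C ∪ {x, y, q, r}) {a, b} := by
  simp only [bundleLabels, Set.insert_subset_iff, Set.singleton_subset_iff,
    inl_mem_parts, inr_mem_parts] at hXD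
  refine eq_of_isSemiInduced_of_le hX (trim_le h.subset) hXJ ?_ fun e he hemult => ?_
  · have : C ⊆ X.vertexSet := hIX.vertexSet_mono
    simp only [vertexSet_trim]
    grind
  · have := mem_of_mem_edgeSet_trim he hemult
    grind

theorem isBundleInterval :
    IsBundleInterval H (trim H C ∅) (trim H (C ∪ {x, y, q, r}) {a, b}) x y a b
      (.inl q) (.inl r) := by
  have hnodup := h.nodup
  have hdisj := h.disjoint
  have hab := h.ne
  simp only [List.nodup_cons, List.mem_cons, List.not_mem_nil, or_false] at hnodup
  simp only [Set.disjoint_insert_right, Set.disjoint_singleton_right] at hdisj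
  have hI := h.trim_isSemiInduced hmult (W := C) (M := ∅) (by grind) (by grind)
  have hJ := h.trim_isSemiInduced hmult (W := C ∪ {x, y, q, r}) (M := {a, b}) (by grind) (by simp)
  have mem_a {W} {M : Set β} := mem_edgeSet_trim (W := W) (M := M) h.isLink_left h.isMultipleEdge.1
  have mem_b {W} {M : Set β} := mem_edgeSet_trim (W := W) (M := M) h.isLink_right h.isMultipleEdge.2
  refine ⟨?nodup, h.isLink_left, h.isLink_right, hI,
    preconnected_of_isSemiInduced hI h.connOn, hJ, preconnected_of_isSemiInduced hJ h.connOn_union,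
    ?disjoint_bot, ?subset_top, ?eq_or_eq, fun _ => h.eq_bot hmult, fun _ => h.eq_top⟩
  case nodup =>
    simp only [List.nodup_cons, List.mem_cons, List.not_mem_nil, Sum.inl.injEq, Sum.inr.injEq,
      reduceCtorEq]
    grind
  case disjoint_bot => simp [bundleLabels, mem_a, mem_b, hdisj]
  case subset_top => simp [bundleLabels, Set.insert_subset_iff, mem_a, mem_b]
  case eq_or_eq =>
    intro e he hxy
    by_cases hea : e = a
    · exact .inl hea
    · exact mem_of_mem_edgeSet_trim (M := {a, b}) he ⟨a, Ne.symm hea, x, y, hxy, h.isLink_left⟩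

theorem exists_not_isShellablePoset (hH : H.vertexSet = C ∪ {x, y, q, r})
    (hV : H.vertexSet.Finite) (hE : H.edgeSet.Finite) :
    ∃ A, H.IsAdmissible A ∧ ¬ Shelling.IsShellablePoset (EvenPoset H A) := by
  have hchain := (h.swap.hasBundleChain hmult).swap
  rw [Set.pair_comm r q] at hchain
  have hnot := (h.isBundleInterval hmult).not_isShellablePoset (S := C) hV hE subset_rfl h.even
    (h.hasBundleChain hmult) hchain
  refine ⟨_, isAdmissible_of_preconnected ?_ ?_, hnot⟩
  · exact preconnected_of_connOn_vertexSet (hH ▸ h.connOn_union)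
  have heven : Even H.vertexSet.ncard :=
    hH ▸ h.even_ncard_union (hV.subset (Set.subset_union_left.trans h.subset))
  have hlabels : (.inl '' C ∪ bundleLabels x y a b (.inl q) (.inl r) : Set (α ⊕ β)) =
      .inl '' H.vertexSet ∪ .inr '' {a, b} := by
    rw [hH]
    ext (z | e) <;> simp [bundleLabels]
  have hedges : ({a, b} ∩ H.edgesBetween x y : Set β) = {a, b} :=
    Set.inter_eq_left.2 (Set.pair_subset h.isLink_left h.isLink_right)
  rw [hlabels]
  refine isAdmissibleConnected_of_edgesBetween subset_rfl heven ?_ (fun _ hx hx' => (hx' hx).elim)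
    fun e he => ⟨x, y, hmult e he, ?_⟩
  · rintro e (rfl | rfl)
    exacts [h.isMultipleEdge.1, h.isMultipleEdge.2]
  · rw [hedges, Set.ncard_pair h.ne]
    exact ⟨Set.insert_nonempty _ _, even_two⟩

end IsBranching

end Branching

section BundlePair

variable {α β : Type*} {G H X : Graph α β} {C : Set α} {x y u v : α} {a b c d : β}

/-! ### Second obstruction: two bundles -/

/-- Two edges `a` and `b` of a bundle join `x` and `y`, two edges `c` and `d` of another bundle
join `u` and `v`, and `y` can be attached to a connected set `C` that contains `u` and neither of
`x`, `y` and `v`. The two bundles may share the vertex `y = v`. -/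
structure IsBundlePair (G : Graph α β) (C : Set α) (x y u v : α) (a b c d : β) : Prop where
  subset : C ⊆ G.vertexSet
  disjoint : Disjoint C {x, y, v}
  mem : u ∈ C
  ne : x ≠ y
  ne' : x ≠ v
  edge_ne : a ≠ b
  edge_ne' : c ≠ d
  isLink_a : G.IsLink a x y
  isLink_b : G.IsLink b x y
  isLink_c : G.IsLink c u v
  isLink_d : G.IsLink d u v
  connOn : ConnOn G C
  connOn_insert : ConnOn G (insert y C)

theorem exists_even_ncard_subset (hC : C.Finite) (hu : u ∈ C) :
    ∃ S ⊆ C, C \ {u} ⊆ S ∧ Even S.ncard := by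
  by_cases h : Even C.ncard
  · exact ⟨C, subset_rfl, Set.sdiff_subset, h⟩
  · refine ⟨C \ {u}, Set.sdiff_subset, subset_rfl, ?_⟩
    rwa [← Set.ncard_sdiff_singleton_add_one hu hC, Nat.even_add_one, not_not] at h

namespace IsBundlePair

theorem swap (h : IsBundlePair G C x y u v a b c d) : IsBundlePair G C x y u v a b d c :=
  { h with
    edge_ne' := h.edge_ne'.symm
    isLink_c := h.isLink_d
    isLink_d := h.isLink_c }

theorem union_subset (h : IsBundlePair G C x y u v a b c d) : C ∪ {x, y, v} ⊆ G.vertexSet := by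
  rintro z (hz | rfl | rfl | rfl)
  exacts [h.subset hz, h.isLink_a.left_mem, h.isLink_a.right_mem, h.isLink_c.right_mem]

theorem isMultipleEdge (h : IsBundlePair G C x y u v a b c d) : G.IsMultipleEdge a ∧
    G.IsMultipleEdge b ∧ G.IsMultipleEdge c ∧ G.IsMultipleEdge d :=
  ⟨⟨b, h.edge_ne.symm, x, y, h.isLink_a, h.isLink_b⟩, ⟨a, h.edge_ne, x, y, h.isLink_b, h.isLink_a⟩,
    ⟨d, h.edge_ne'.symm, u, v, h.isLink_c, h.isLink_d⟩,
    ⟨c, h.edge_ne', u, v, h.isLink_d, h.isLink_c⟩⟩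

theorem notMem (h : IsBundlePair G C x y u v a b c d) : x ∉ C ∧ y ∉ C ∧ v ∉ C := by
  simpa only [Set.disjoint_insert_right, Set.disjoint_singleton_right] using h.disjoint

theorem not_isLink (h : IsBundlePair G C x y u v a b c d) {e : β} (he : G.IsLink e x y) :
    ¬ G.IsLink e u v := by
  intro he'
  obtain rfl | rfl := he'.left_eq_or_eq he
  exacts [h.notMem.1 h.mem, h.notMem.2.1 h.mem]

theorem edge_nodup (h : IsBundlePair G C x y u v a b c d) : [a, b, c, d].Nodup := by
  have h_ac : a ≠ c := fun hac => h.not_isLink h.isLink_a (hac ▸ h.isLink_c)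
  have h_ad : a ≠ d := fun had => h.not_isLink h.isLink_a (had ▸ h.isLink_d)
  have h_bc : b ≠ c := fun hbc => h.not_isLink h.isLink_b (hbc ▸ h.isLink_c)
  have h_bd : b ≠ d := fun hbd => h.not_isLink h.isLink_b (hbd ▸ h.isLink_d)
  simp [h_ac, h_ad, h_bc, h_bd, h.edge_ne, h.edge_ne']

theorem connOn_insert_insert (h : IsBundlePair G C x y u v a b c d) :
    ConnOn G (insert v (insert y C)) :=
  h.connOn_insert.insert (Set.mem_insert_of_mem _ h.mem) h.isLink_c.adj

theorem connOn_union (h : IsBundlePair G C x y u v a b c d) : ConnOn G (C ∪ {x, y, v}) := by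
  convert! h.connOn_insert_insert.insert (w := y) (by simp) h.isLink_a.symm.adj using 1
  grind

variable (h : IsBundlePair H C x y u v a b c d)
  (hmult : ∀ e, H.IsMultipleEdge e → H.IsLink e x y ∨ H.IsLink e u v)

include h hmult

theorem trim_isSemiInduced {W : Set α} {M : Set β} (hW : W ⊆ C ∪ {x, y, v})
    (ha : x ∈ W → y ∈ W → a ∈ M) (hc : u ∈ W → v ∈ W → c ∈ M) :
    (trim H W M).IsSemiInduced H := by
  refine Multigraph.trim_isSemiInduced (hW.trans h.union_subset) fun e he => ?_
  obtain hxy | huv := hmult e he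
  · exact ⟨x, y, hxy, fun hx hy => ⟨a, ha hx hy, h.isLink_a⟩⟩
  · exact ⟨u, v, huv, fun hu hv => ⟨c, hc hu hv, h.isLink_c⟩⟩

theorem hasBundleChain : HasBundleChain H (trim H C ∅) (trim H (C ∪ {x, y, v}) {a, b, c, d})
    x y a b (.inr c) (.inr d) (.inr c) := by
  obtain ⟨hxC, hyC, hvC⟩ := h.notMem
  have huC := h.mem
  have hxy := h.ne
  have hxv := h.ne'
  have hnodup := h.edge_nodup
  simp only [List.nodup_cons, List.mem_cons, List.not_mem_nil, or_false] at hnodup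
  have hX := h.trim_isSemiInduced hmult (W := insert v (insert y C)) (M := {a, c}) (by grind)
    (by simp) (by simp)
  have hY := h.trim_isSemiInduced hmult (W := C ∪ {x, y, v}) (M := {a, c}) (by grind) (by simp)
    (by simp)
  have mem_a {W} := mem_edgeSet_trim (W := W) (M := {a, c}) h.isLink_a h.isMultipleEdge.1
  have mem_b {W} := mem_edgeSet_trim (W := W) (M := {a, c}) h.isLink_b h.isMultipleEdge.2.1
  have mem_c {W} := mem_edgeSet_trim (W := W) (M := {a, c}) h.isLink_c h.isMultipleEdge.2.2.1
  have mem_d {W} := mem_edgeSet_trim (W := W) (M := {a, c}) h.isLink_d h.isMultipleEdge.2.2.2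
  refine ⟨.inl y, .inr rfl, _, _, hX, hY,
    preconnected_of_isSemiInduced hX h.connOn_insert_insert,
    preconnected_of_isSemiInduced hY h.connOn_union,
    trim_mono (by grind) (by simp), trim_mono (by grind) subset_rfl,
    trim_mono (by grind) (by grind), ?_, ?_⟩
  all_goals
    ext (z | e) <;> simp only [bundleLabels, Set.mem_inter_iff, Set.mem_insert_iff,
      Set.mem_singleton_iff, inl_mem_parts, inr_mem_parts, Sum.inl.injEq, Sum.inr.injEq,
      reduceCtorEq, vertexSet_trim] <;> grind

theorem eq_bot (hX : X.IsSemiInduced H) (hIX : trim H C ∅ ≤ X)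
    (hXJ : X ≤ trim H (C ∪ {x, y, v}) {a, b, c, d})
    (hXD : Disjoint (parts X) (bundleLabels x y a b (.inr c) (.inr d))) : X = trim H C ∅ := by
  simp only [bundleLabels, Set.disjoint_insert_right, Set.disjoint_singleton_right,
    inl_mem_parts, inr_mem_parts] at hXD
  have hI := h.trim_isSemiInduced hmult (W := C) (M := ∅) Set.subset_union_left
    (fun hx => (h.notMem.1 hx).elim) (fun _ hv => (h.notMem.2.2 hv).elim)
  have not_mult {e : β} (he : e ∈ X.edgeSet) (hemult : H.IsMultipleEdge e) : False := by
    have := mem_of_mem_edgeSet_trim (M := {a, b, c, d}) (hXJ.edgeSet_mono he) hemult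
    grind
  have hvX : v ∉ X.vertexSet := by
    intro hv
    obtain ⟨e, he⟩ := hX.2 u (hIX.vertexSet_mono h.mem) v hv h.isLink_c.adj
    have hce : c ≠ e := fun hce => hXD.2.2.2.2.1 (hce ▸ he.edge_mem)
    exact not_mult he.edge_mem ⟨c, hce, u, v, he.mono hX.1, h.isLink_c⟩
  refine (eq_of_isSemiInduced_of_le hI hX.1 hIX (fun z hz => ?_) fun e he hemult =>
    (not_mult he hemult).elim).symm
  have hzJ := hXJ.vertexSet_mono hz
  simp only [vertexSet_trim] at hzJ ⊢
  grind

omit hmult in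
theorem eq_top (hX : X.IsSemiInduced H) (hIX : trim H C ∅ ≤ X)
    (hXJ : X ≤ trim H (C ∪ {x, y, v}) {a, b, c, d})
    (hXD : bundleLabels x y a b (.inr c) (.inr d) ⊆ parts X) :
    X = trim H (C ∪ {x, y, v}) {a, b, c, d} := by
  simp only [bundleLabels, Set.insert_subset_iff, Set.singleton_subset_iff,
    inl_mem_parts, inr_mem_parts] at hXD
  refine eq_of_isSemiInduced_of_le hX (trim_le h.union_subset) hXJ ?_ fun e he hemult => ?_
  · have hCX : C ⊆ X.vertexSet := hIX.vertexSet_mono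
    have hvX := ((hX.1.isLink_iff hXD.2.2.2.2.1).2 h.isLink_c).right_mem
    simp only [vertexSet_trim]
    grind
  · have := mem_of_mem_edgeSet_trim he hemult
    grind

theorem isBundleInterval : IsBundleInterval H (trim H C ∅) (trim H (C ∪ {x, y, v}) {a, b, c, d})
    x y a b (.inr c) (.inr d) := by
  obtain ⟨hxC, hyC, hvC⟩ := h.notMem
  have huC := h.mem
  have hI := h.trim_isSemiInduced hmult (W := C) (M := ∅) Set.subset_union_left (by grind)
    (by grind)
  have hJ := h.trim_isSemiInduced hmult (W := C ∪ {x, y, v}) (M := {a, b, c, d}) subset_rfl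
    (by simp) (by simp)
  obtain ⟨ha, hb, hc, hd⟩ := h.isMultipleEdge
  refine ⟨?nodup, h.isLink_a, h.isLink_b, hI, preconnected_of_isSemiInduced hI h.connOn, hJ,
    preconnected_of_isSemiInduced hJ h.connOn_union, ?disjoint_bot, ?subset_top, ?eq_or_eq,
    fun _ => h.eq_bot hmult, fun _ => h.eq_top⟩
  case nodup =>
    have hxy := h.ne
    have hnodup := h.edge_nodup
    simp only [List.nodup_cons, List.mem_cons, List.not_mem_nil, Sum.inl.injEq, Sum.inr.injEq,
      reduceCtorEq] at hnodup ⊢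
    grind
  case disjoint_bot =>
    simp [bundleLabels, mem_edgeSet_trim h.isLink_a ha, mem_edgeSet_trim h.isLink_b hb,
      mem_edgeSet_trim h.isLink_c hc, mem_edgeSet_trim h.isLink_d hd, hxC, hyC]
  case subset_top =>
    simp [bundleLabels, Set.insert_subset_iff, mem_edgeSet_trim h.isLink_a ha,
      mem_edgeSet_trim h.isLink_b hb, mem_edgeSet_trim h.isLink_c hc,
      mem_edgeSet_trim h.isLink_d hd, huC]
  case eq_or_eq =>
    intro e he hexy
    by_cases hea : e = a
    · exact .inl hea
    obtain rfl | rfl | rfl | rfl := mem_of_mem_edgeSet_trim (M := {a, b, c, d}) he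
      ⟨a, Ne.symm hea, x, y, hexy, h.isLink_a⟩
    · exact .inl rfl
    · exact .inr rfl
    · exact (h.not_isLink hexy h.isLink_c).elim
    · exact (h.not_isLink hexy h.isLink_d).elim

omit hmult in
theorem inter_edgesBetween : {a, b, c, d} ∩ H.edgesBetween x y = {a, b} ∧
    {a, b, c, d} ∩ H.edgesBetween u v = {c, d} := by
  have ha : a ∈ H.edgesBetween x y := h.isLink_a
  have hb : b ∈ H.edgesBetween x y := h.isLink_b
  have hc : c ∈ H.edgesBetween u v := h.isLink_c
  have hd : d ∈ H.edgesBetween u v := h.isLink_d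
  have hdisj : Disjoint (H.edgesBetween x y) (H.edgesBetween u v) :=
    Set.disjoint_left.2 fun _ => h.not_isLink
  have ha' := hdisj.notMem_of_mem_left ha
  have hb' := hdisj.notMem_of_mem_left hb
  have hc' := hdisj.notMem_of_mem_right hc
  have hd' := hdisj.notMem_of_mem_right hd
  grind

omit hmult in
theorem even_ncard_union {S : Set α} (hSC : S ⊆ C) (hS : S.Finite) (hSeven : Even S.ncard) :
    Even (S ∪ {x, y}).ncard := by
  rw [Set.ncard_union_eq ((h.disjoint.mono_left hSC).mono_right (by grind)) hS (by simp),
    Set.ncard_pair h.ne]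
  exact hSeven.add even_two

theorem exists_not_isShellablePoset (hH : H.vertexSet = C ∪ {x, y, v})
    (hV : H.vertexSet.Finite) (hE : H.edgeSet.Finite) :
    ∃ A, H.IsAdmissible A ∧ ¬ Shelling.IsShellablePoset (EvenPoset H A) := by
  obtain ⟨S, hSC, hCS, hSeven⟩ := exists_even_ncard_subset (hV.subset h.subset) h.mem
  have hchain := (h.swap.hasBundleChain hmult).swap
  rw [Set.pair_comm d c] at hchain
  have hnot := (h.isBundleInterval hmult).not_isShellablePoset hV hE hSC hSeven
    (h.hasBundleChain hmult) hchain
  refine ⟨_, isAdmissible_of_preconnected ?_ ?_, hnot⟩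
  · exact preconnected_of_connOn_vertexSet (hH ▸ h.connOn_union)
  have hlabels : (.inl '' S ∪ bundleLabels x y a b (.inr c) (.inr d) : Set (α ⊕ β)) =
      .inl '' (S ∪ {x, y}) ∪ .inr '' {a, b, c, d} := by
    ext (z | e) <;> simp [bundleLabels]
  rw [hlabels]
  refine isAdmissibleConnected_of_edgesBetween ?_
    (h.even_ncard_union hSC ((hV.subset h.subset).subset hSC) hSeven) ?_ ?_ fun e he => ?_
  · exact (Set.union_subset_union hSC (by grind)).trans h.union_subset
  · obtain ⟨ha, hb, hc, hd⟩ := h.isMultipleEdge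
    rintro e (rfl | rfl | rfl | rfl) <;> assumption
  · intro z hz hzW
    rw [hH] at hz
    obtain rfl | rfl : z = u ∨ z = v := by grind
    · exact ⟨c, h.isLink_c.inc_left, h.isMultipleEdge.2.2.1⟩
    · exact ⟨c, h.isLink_c.inc_right, h.isMultipleEdge.2.2.1⟩
  · obtain hxy | huv := hmult e he
    · refine ⟨x, y, hxy, ?_⟩
      rw [h.inter_edgesBetween.1, Set.ncard_pair h.edge_ne]
      exact ⟨Set.insert_nonempty _ _, even_two⟩
    · refine ⟨u, v, huv, ?_⟩
      rw [h.inter_edgesBetween.2, Set.ncard_pair h.edge_ne']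
      exact ⟨Set.insert_nonempty _ _, even_two⟩

end IsBundlePair

end BundlePair

section PIGraph

variable {α β : Type*} {G : Graph α β} {C W : Set α} {P : Set (Sym2 α)}

/-! ### Partial underlying induced graphs -/

/-- A set of edges that contains exactly one edge between any two adjacent vertices. -/
def IsTransversal (G : Graph α β) (R : Set β) : Prop :=
  ∀ e x y, G.IsLink e x y → ∃! f, f ∈ R ∧ G.IsLink f x y

theorem exists_isTransversal (G : Graph α β) : ∃ R, IsTransversal G R := by
  let rep : Quotient (Setoid.ker G.IsLink) → β := Quotient.out
  refine ⟨Set.range rep, fun e x y he => ⟨rep ⟦e⟧, ⟨⟨_, rfl⟩, ?_⟩, ?_⟩⟩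
  · have hrep : G.IsLink (rep ⟦e⟧) = G.IsLink e := Quotient.mk_out (s := Setoid.ker G.IsLink) e
    rwa [hrep]
  · rintro _ ⟨⟨p, rfl⟩, hp⟩
    have hker : G.IsLink (rep p) = G.IsLink e := by
      ext u v
      rw [hp.isLink_iff_sym2_eq, he.isLink_iff_sym2_eq]
    rw [← p.out_eq, Quotient.sound (s := Setoid.ker G.IsLink) hker]

/-- The partial underlying graph of `G` that keeps the bundles between the pairs in `P`, and keeps
only the edges in `R` of the other bundles. -/
def underlying (G : Graph α β) (R : Set β) (P : Set (Sym2 α)) : Graph α β :=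
  G.restrict {e | e ∈ R ∨ ∃ x y, s(x, y) ∈ P ∧ G.IsLink e x y}

theorem underlying_isLink {R : Set β} {e : β} {x y : α} :
    (underlying G R P).IsLink e x y ↔ G.IsLink e x y ∧ (e ∈ R ∨ s(x, y) ∈ P) := by
  simp only [underlying, restrict, Set.mem_ofPred_eq]
  constructor
  · rintro ⟨heR | ⟨u, v, huv, he'⟩, he⟩
    · exact ⟨he, .inl heR⟩
    · exact ⟨he, .inr (he'.isLink_iff_sym2_eq.1 he ▸ huv)⟩
  · rintro ⟨he, heR | heP⟩
    exacts [⟨.inl heR, he⟩, ⟨.inr ⟨x, y, heP, he⟩, he⟩]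

theorem underlying_isPartialUnderlying {R : Set β} (hR : IsTransversal G R) (P : Set (Sym2 α)) :
    (underlying G R P).IsPartialUnderlying G := by
  refine ⟨⟨restrict_le, rfl⟩, fun x y => ?_⟩
  by_cases hxy : s(x, y) ∈ P
  · exact .inl (Set.ext fun e => by simp [edgesBetween, underlying_isLink, hxy])
  by_cases hbundle : (G.edgesBetween x y).Nontrivial
  · obtain ⟨e, he⟩ := hbundle.nonempty
    obtain ⟨f, hf, hf_unique⟩ := hR e x y he
    refine .inr ⟨⟨hbundle, x, y, rfl⟩, f, Set.ext fun g => ?_⟩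
    simp only [edgesBetween, Set.mem_ofPred_eq, underlying_isLink, hxy, or_false,
      Set.mem_singleton_iff]
    exact ⟨fun ⟨hg, hgR⟩ => hf_unique g ⟨hgR, hg⟩, fun hgf => hgf ▸ hf.symm⟩
  · refine .inl (Set.ext fun e => ⟨fun he => (underlying_isLink.1 he).1, fun he => ?_⟩)
    obtain ⟨f, ⟨hfR, hf⟩, -⟩ := hR e x y he
    obtain rfl : f = e := Set.not_nontrivial_iff.1 hbundle hf he
    exact underlying_isLink.2 ⟨hf, .inl hfR⟩

theorem exists_isPIGraph (G : Graph α β) (P : Set (Sym2 α)) (hW : W ⊆ G.vertexSet) :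
    ∃ H : Graph α β, H.IsPIGraph G ∧ H.vertexSet = W ∧ H ≤ G ∧
      (∀ x ∈ W, ∀ y ∈ W, G.Adj x y → H.Adj x y) ∧
      (∀ e, ∀ x ∈ W, ∀ y ∈ W, s(x, y) ∈ P → G.IsLink e x y → H.IsLink e x y) ∧
      ∀ e, H.IsMultipleEdge e → ∃ x y, s(x, y) ∈ P ∧ H.IsLink e x y := by
  obtain ⟨R, hR⟩ := exists_isTransversal G
  have hle : (underlying G R P).induce W ≤ underlying G R P := induce_le hW
  refine ⟨_, ⟨_, underlying_isPartialUnderlying hR P, hle, fun e x y h hx hy => ⟨h, hx, hy⟩⟩, rfl,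
    hle.trans restrict_le, ?_, ?_, ?_⟩
  · rintro x hx y hy ⟨e, he⟩
    obtain ⟨f, ⟨hfR, hf⟩, -⟩ := hR e x y he
    exact ⟨f, underlying_isLink.2 ⟨hf, .inl hfR⟩, hx, hy⟩
  · exact fun e x hx y hy hxy he => ⟨underlying_isLink.2 ⟨he, .inr hxy⟩, hx, hy⟩
  · rintro e ⟨f, hfe, x, y, he, hf⟩
    refine ⟨x, y, ?_, he⟩
    obtain ⟨heG, heR⟩ := underlying_isLink.1 he.1
    obtain ⟨hfG, hfR⟩ := underlying_isLink.1 hf.1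
    by_contra hxy
    exact hfe ((hR e x y heG).unique ⟨hfR.resolve_right hxy, hfG⟩ ⟨heR.resolve_right hxy, heG⟩)

theorem IsBranching.not_inGStar {x y q r : α} {a b : β} (h : IsBranching G C x y q r a b)
    (hV : G.vertexSet.Finite) (hE : G.edgeSet.Finite) : ¬ G.InGStar := by
  intro hG
  obtain ⟨H, hPI, hVH, hHG, hadj, hlink, hmult⟩ := exists_isPIGraph G {s(x, y)} h.subset
  have hlink_xy (e : β) (he : G.IsLink e x y) : H.IsLink e x y :=
    hlink e x (by simp) y (by simp) rfl he
  have connOn {W : Set α} (hW : W ⊆ C ∪ {x, y, q, r}) (hconn : ConnOn G W) : ConnOn H W :=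
    hconn.of_adj fun u hu v hv => hadj u (hW hu) v (hW hv)
  have hH : IsBranching H C x y q r a b :=
    { h with
      subset := hVH.superset
      isLink_left := hlink_xy a h.isLink_left
      isLink_right := hlink_xy b h.isLink_right
      connOn := connOn Set.subset_union_left h.connOn
      connOn_left := h.connOn_left.imp (connOn (by grind)) (connOn (by grind))
      connOn_right := h.connOn_right.imp (connOn (by grind)) (connOn (by grind)) }
  have hbundle (e : β) (he : H.IsMultipleEdge e) : H.IsLink e x y := by
    obtain ⟨u, v, huv, he⟩ := hmult e he
    exact he.isLink_iff_sym2_eq.2 huv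
  obtain ⟨A, hA, hnot⟩ := hH.exists_not_isShellablePoset hbundle hVH
    (hV.subset hHG.vertexSet_mono) (hE.subset hHG.edgeSet_mono)
  exact hnot (hG H hPI A hA)

theorem IsBundlePair.not_inGStar {x y u v : α} {a b c d : β}
    (h : IsBundlePair G C x y u v a b c d) (hV : G.vertexSet.Finite) (hE : G.edgeSet.Finite) :
    ¬ G.InGStar := by
  intro hG
  obtain ⟨H, hPI, hVH, hHG, hadj, hlink, hmult⟩ :=
    exists_isPIGraph G {s(x, y), s(u, v)} h.union_subset
  have hlink_xy (e : β) (he : G.IsLink e x y) : H.IsLink e x y :=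
    hlink e x (by simp) y (by simp) (by simp) he
  have hlink_uv (e : β) (he : G.IsLink e u v) : H.IsLink e u v :=
    hlink e u (.inl h.mem) v (by simp) (by simp) he
  have connOn {W : Set α} (hW : W ⊆ C ∪ {x, y, v}) (hconn : ConnOn G W) : ConnOn H W :=
    hconn.of_adj fun u hu v hv => hadj u (hW hu) v (hW hv)
  have hH : IsBundlePair H C x y u v a b c d :=
    { h with
      subset := Set.subset_union_left.trans hVH.superset
      isLink_a := hlink_xy a h.isLink_a
      isLink_b := hlink_xy b h.isLink_b
      isLink_c := hlink_uv c h.isLink_c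
      isLink_d := hlink_uv d h.isLink_d
      connOn := connOn Set.subset_union_left h.connOn
      connOn_insert := connOn (by grind) h.connOn_insert }
  have hbundle (e : β) (he : H.IsMultipleEdge e) : H.IsLink e x y ∨ H.IsLink e u v := by
    obtain ⟨s, t, hst | hst, he⟩ := hmult e he
    exacts [.inl (he.isLink_iff_sym2_eq.2 hst), .inr (he.isLink_iff_sym2_eq.2 hst)]
  obtain ⟨A, hA, hnot⟩ := hH.exists_not_isShellablePoset hbundle hVH
    (hV.subset hHG.vertexSet_mono) (hE.subset hHG.edgeSet_mono)
  exact hnot (hG H hPI A hA)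

end PIGraph

section OnlyBundle

variable {α β : Type*} {G : Graph α β}

/-! ### Uniqueness of the bundle -/

/-- The only two vertices of `G` joined by several edges are `x` and `y`. -/
def IsOnlyBundle (G : Graph α β) (x y : α) : Prop :=
  (G.edgesBetween x y).Nontrivial ∧
    ∀ u v, (G.edgesBetween u v).Nontrivial → s(u, v) = s(x, y)

theorem edgesBetween_comm (G : Graph α β) (x y : α) :
    G.edgesBetween x y = G.edgesBetween y x :=
  Set.ext fun _ => isLink_comm

theorem finite_edgesBetween (hE : G.edgeSet.Finite) (x y : α) : (G.edgesBetween x y).Finite :=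
  hE.subset fun _ he => IsLink.edge_mem he

theorem ne_of_nontrivial_edgesBetween [G.Loopless] {x y : α}
    (h : (G.edgesBetween x y).Nontrivial) : x ≠ y :=
  IsLink.ne h.nonempty.some_mem

theorem mem_of_nontrivial_edgesBetween {x y : α} (h : (G.edgesBetween x y).Nontrivial) :
    x ∈ G.vertexSet ∧ y ∈ G.vertexSet :=
  have he : G.IsLink _ x y := h.nonempty.some_mem
  ⟨he.left_mem, he.right_mem⟩

theorem exists_connOn_between {S T : Set α} {x z : α} (hx : x ∈ S) (hz : z ∈ T)
    (hST : Disjoint S T) (h : Relation.ReflTransGen G.Adj x z) :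
    ∃ C ⊆ G.vertexSet, ConnOn G C ∧ Disjoint C S ∧ (∃ s ∈ S, ∃ w ∈ C, G.Adj s w) ∧
      ∃ t ∈ T, C ∩ T = {t} := by
  by_contra hcon
  have hreach (w : α) (hw : Relation.ReflTransGen G.Adj x w) : w ∈ S ∨ ∃ C ⊆ G.vertexSet,
      ConnOn G C ∧ Disjoint C S ∧ (∃ s ∈ S, ∃ w ∈ C, G.Adj s w) ∧ w ∈ C ∧ C ∩ T ⊆ {w} := by
    induction hw with
    | refl => exact .inl hx
    | @tail v w _ hvw ih =>
      by_cases hwS : w ∈ S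
      · exact .inl hwS
      refine .inr ?_
      obtain hvS | ⟨C, hCV, hC, hCS, ⟨s, hs, u, hu, hsu⟩, hvC, hCT⟩ := ih
      · exact ⟨{w}, by simpa using hvw.right_mem, connOn_singleton G w, by simpa using hwS,
          ⟨v, hvS, w, rfl, hvw⟩, rfl, Set.inter_subset_left⟩
      · have hvT : v ∉ T := fun hvT => hcon
          ⟨C, hCV, hC, hCS, ⟨s, hs, u, hu, hsu⟩, v, hvT, hCT.antisymm (by simp [hvC, hvT])⟩
        refine ⟨insert w C, Set.insert_subset hvw.right_mem hCV, hC.insert hvC hvw,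
          Set.disjoint_insert_left.2 ⟨hwS, hCS⟩, ⟨s, hs, u, .inr hu, hsu⟩, .inl rfl, ?_⟩
        rintro t ⟨rfl | htC, htT⟩
        · rfl
        · exact absurd ((hCT ⟨htC, htT⟩ : t = v) ▸ htT) hvT
  obtain hzS | ⟨C, hCV, hC, hCS, hadj, hzC, hCT⟩ := hreach z h
  · exact Set.disjoint_left.1 hST hzS hz
  · exact hcon ⟨C, hCV, hC, hCS, hadj, z, hz, hCT.antisymm (by simp [hz, hzC])⟩

theorem eq_of_nontrivial_edgesBetween [G.Loopless] (hG : G.InGStar) (hV : G.vertexSet.Finite)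
    (hE : G.edgeSet.Finite) {x y u : α} (hx : (G.edgesBetween x y).Nontrivial)
    (hu : (G.edgesBetween u y).Nontrivial) : u = x := by
  by_contra hux
  have hxy := ne_of_nontrivial_edgesBetween hx
  have huy := ne_of_nontrivial_edgesBetween hu
  obtain ⟨a, ha, b, hb, hab⟩ := hx
  obtain ⟨c, hc : G.IsLink c u y, d, hd, hcd⟩ := hu
  have hpair : IsBundlePair G {u} x y u y a b c d :=
    { subset := by simpa using hc.left_mem
      disjoint := by grind
      mem := rfl
      ne := hxy
      ne' := hxy
      edge_ne := hab
      edge_ne' := hcd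
      isLink_a := ha
      isLink_b := hb
      isLink_c := hc
      isLink_d := hd
      connOn := connOn_singleton G u
      connOn_insert := connOn_pair hc.symm.adj }
  exact hpair.not_inGStar hV hE hG

theorem exists_eq_pair_of_mem {x y s : α} (h : (G.edgesBetween x y).Nontrivial)
    (hs : s ∈ ({x, y} : Set α)) :
    ∃ t, ({x, y} : Set α) = {t, s} ∧ s(x, y) = s(t, s) ∧ (G.edgesBetween t s).Nontrivial := by
  obtain rfl | rfl := hs
  · exact ⟨y, Set.pair_comm _ _, Sym2.eq_swap, edgesBetween_comm G s y ▸ h⟩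
  · exact ⟨x, rfl, rfl, h⟩

theorem not_disjoint_of_nontrivial_edgesBetween [G.Loopless] (hG : G.InGStar)
    (hV : G.vertexSet.Finite) (hE : G.edgeSet.Finite) (hconn : Preconnected G) {x y u v : α}
    (hx : (G.edgesBetween x y).Nontrivial) (hu : (G.edgesBetween u v).Nontrivial) :
    ¬ Disjoint ({x, y} : Set α) {u, v} := by
  intro hdisj
  obtain ⟨C, hCV, hC, hCx, ⟨s, hs, w, hw, hsw⟩, t, ht, hCu⟩ := exists_connOn_between
    (Set.mem_insert x _) (Set.mem_insert u _) hdisj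
    (hconn x (mem_of_nontrivial_edgesBetween hx).1 u (mem_of_nontrivial_edgesBetween hu).1)
  obtain ⟨x', hx', -, hxs⟩ := exists_eq_pair_of_mem hx hs
  obtain ⟨v', hv', -, hvt⟩ := exists_eq_pair_of_mem hu ht
  rw [hx'] at hdisj hCx
  rw [hv'] at hdisj hCu
  have hxs_ne := ne_of_nontrivial_edgesBetween hxs
  have hvt_ne := ne_of_nontrivial_edgesBetween hvt
  rw [edgesBetween_comm] at hvt
  obtain ⟨a, ha, b, hb, hab⟩ := hxs
  obtain ⟨c, hc, d, hd, hcd⟩ := hvt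
  have htC : t ∈ C := (hCu.symm.subset rfl).1
  have hv'C : v' ∉ C := fun hv' => hvt_ne (hCu ▸ ⟨hv', .inl rfl⟩ : v' ∈ ({t} : Set α))
  have hpair : IsBundlePair G C x' s t v' a b c d :=
    { subset := hCV
      disjoint := by
        simp only [Set.disjoint_insert_right, Set.disjoint_singleton_right] at hCx ⊢
        exact ⟨hCx.1, hCx.2, hv'C⟩
      mem := htC
      ne := hxs_ne
      ne' := by grind
      edge_ne := hab
      edge_ne' := hcd
      isLink_a := ha
      isLink_b := hb
      isLink_c := hc
      isLink_d := hd
      connOn := hC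
      connOn_insert := hC.insert hw hsw.symm }
  exact hpair.not_inGStar hV hE hG

theorem isOnlyBundle_of_inGStar [G.Loopless] (hG : G.InGStar) (hV : G.vertexSet.Finite)
    (hE : G.edgeSet.Finite) (hconn : Preconnected G) {x y : α}
    (hx : (G.edgesBetween x y).Nontrivial) : IsOnlyBundle G x y := by
  refine ⟨hx, fun u v hu => ?_⟩
  obtain ⟨z, hzx, hzu⟩ := Set.not_disjoint_iff.1
    (not_disjoint_of_nontrivial_edgesBetween hG hV hE hconn hx hu)
  obtain ⟨x', -, hx', hx'z⟩ := exists_eq_pair_of_mem hx hzx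
  obtain ⟨u', -, hu', hu'z⟩ := exists_eq_pair_of_mem hu hzu
  rw [hx', hu', eq_of_nontrivial_edgesBetween hG hV hE hx'z hu'z]

/-! ### Recognizing the graphs with one bundle -/

theorem exists_ends (G : Graph α β) : ∃ ends : G.edgeSet → Sym2 G.vertexSet,
    ∀ (e : G.edgeSet) (x y : G.vertexSet), G.IsLink e x y ↔ ends e = s(x, y) := by
  have hends (e : G.edgeSet) : ∃ p : Sym2 G.vertexSet,
      ∀ x y : G.vertexSet, G.IsLink e x y ↔ p = s(x, y) := by
    obtain ⟨u, v, huv⟩ := exists_isLink_of_mem_edgeSet e.2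
    refine ⟨s(⟨u, huv.left_mem⟩, ⟨v, huv.right_mem⟩), fun x y => ?_⟩
    rw [huv.isLink_iff_sym2_eq, ← (Sym2.map.injective Subtype.val_injective).eq_iff]
    simp only [Sym2.map_mk]
  choose ends hends using hends
  exact ⟨ends, hends⟩

theorem ncard_edgesBetween {ends : G.edgeSet → Sym2 G.vertexSet}
    (hends : ∀ (e : G.edgeSet) (x y : G.vertexSet), G.IsLink e x y ↔ ends e = s(x, y))
    (x y : G.vertexSet) : (G.edgesBetween x y).ncard = {e | ends e = s(x, y)}.ncard := by
  rw [← Set.ncard_image_of_injective _ Subtype.val_injective]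
  congr 1
  ext e
  simp only [← hends]
  exact ⟨fun he => ⟨⟨e, IsLink.edge_mem he⟩, he, rfl⟩, by rintro ⟨e, he, rfl⟩; exact he⟩

theorem isomorphic_of_ncard_edgesBetween {α' β' : Type*} {G' : Graph α' β'}
    (hE : G.edgeSet.Finite) (hE' : G'.edgeSet.Finite) (φ : G.vertexSet ≃ G'.vertexSet)
    (h : ∀ x y : G.vertexSet,
      (G.edgesBetween x y).ncard = (G'.edgesBetween (φ x) (φ y)).ncard) : G.Isomorphic G' := by
  obtain ⟨ends, hends⟩ := exists_ends G
  obtain ⟨ends', hends'⟩ := exists_ends G'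
  have := hE.to_subtype
  have := hE'.to_subtype
  have hfiber (p : Sym2 G.vertexSet) :
      Nonempty ({e // ends e = p} ≃ {e // ends' e = Sym2.map φ p}) := by
    induction p with | _ x y
    have hncard := h x y
    rw [ncard_edgesBetween hends, ncard_edgesBetween hends'] at hncard
    exact Finite.card_eq.1 hncard
  let ψ (p : Sym2 G.vertexSet) := (hfiber p).some
  let φ₂ : Sym2 G.vertexSet ≃ Sym2 G'.vertexSet :=
    { toFun := Sym2.map φ
      invFun := Sym2.map φ.symm
      left_inv p := by simp [Sym2.map_map]
      right_inv p := by simp [Sym2.map_map] }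
  let g : G.edgeSet ≃ G'.edgeSet := (Equiv.sigmaFiberEquiv ends).symm.trans
    ((Equiv.sigmaCongr φ₂ ψ).trans (Equiv.sigmaFiberEquiv ends'))
  have hg (e : G.edgeSet) : ends' (g e) = Sym2.map φ (ends e) := (ψ (ends e) ⟨e, rfl⟩).2
  refine ⟨φ, g, fun e x y => ?_⟩
  rw [hends, hends', hg, ← Sym2.map_mk, (Sym2.map.injective φ.injective).eq_iff]

end OnlyBundle

section WithBundle

variable {α β : Type*} {G : Graph α β} {n m i j k : ℕ} {S : Set (Sym2 ℕ)} {f : ℕ → α}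

theorem ncard_edgesBetween_withBundle (hi : i < n) (hj : j < n) (hS : s(0, 1) ∉ S)
    (hij : s(i, j) = s(0, 1)) : ((withBundle n m S).edgesBetween i j).ncard = m := by
  have hedges : (withBundle n m S).edgesBetween i j = Sum.inl '' Set.Iio m := by
    ext e
    simp only [edgesBetween, withBundle, Set.mem_ofPred_eq, hi, hj, hij, hS, true_and, and_true,
      false_and, or_false, Set.mem_image, Set.mem_Iio, eq_comm]
  rw [hedges, Set.ncard_image_of_injective _ Sum.inl_injective]
  simp [Set.ncard_eq_toFinset_card']

theorem edgesBetween_withBundle (hi : i < n) (hj : j < n) (hij : s(i, j) ≠ s(0, 1)) :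
    (withBundle n m S).edgesBetween i j = {e | s(i, j) ∈ S ∧ e = Sum.inr s(i, j)} := by
  ext e
  simp only [edgesBetween, withBundle, Set.mem_ofPred_eq, hi, hj, hij, true_and, and_false,
    exists_false, false_or]

theorem finite_edgeSet_withBundle (n m : ℕ) (S : Set (Sym2 ℕ)) :
    (withBundle n m S).edgeSet.Finite := by
  refine (((Set.finite_Iio m).image Sum.inl).union
    (((Set.finite_Iio n).prod (Set.finite_Iio n)).image
      fun p => Sum.inr s(p.1, p.2))).subset fun e he => ?_
  obtain ⟨x, y, hx, hy, ⟨i, hi, rfl, -⟩ | ⟨-, rfl⟩⟩ := exists_isLink_of_mem_edgeSet he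
  · exact .inl ⟨i, hi, rfl⟩
  · exact .inr ⟨(x, y), ⟨hx, hy⟩, rfl⟩

theorem IsOnlyBundle.subsingleton_edgesBetween {x y u v : α} (h : IsOnlyBundle G x y)
    (huv : s(u, v) ≠ s(x, y)) : (G.edgesBetween u v).Subsingleton :=
  Set.not_nontrivial_iff.1 fun h' => huv (h.2 u v h')

theorem isomorphic_withBundle (hE : G.edgeSet.Finite) (hn : 2 ≤ n)
    (hf : Set.BijOn f {v | v < n} G.vertexSet) (hB : IsOnlyBundle G (f 0) (f 1))
    (hS : s(0, 1) ∉ S) (hadj : ∀ i j, i ≤ j → j < n → s(i, j) ≠ s(0, 1) →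
      (G.Adj (f i) (f j) ↔ s(i, j) ∈ S)) :
    G.Isomorphic (withBundle n (G.edgesBetween (f 0) (f 1)).ncard S) := by
  have hncard (i j : ℕ) (hi : i < n) (hj : j < n) : (G.edgesBetween (f i) (f j)).ncard =
      ((withBundle n (G.edgesBetween (f 0) (f 1)).ncard S).edgesBetween i j).ncard := by
    wlog hle : i ≤ j generalizing i j
    · rw [edgesBetween_comm, edgesBetween_comm _ i]
      exact this j i hj hi (Nat.le_of_not_le hle)
    by_cases hij : s(i, j) = s(0, 1)
    · rw [ncard_edgesBetween_withBundle hi hj hS hij]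
      obtain ⟨rfl, rfl⟩ | ⟨rfl, rfl⟩ := Sym2.eq_iff.1 hij
      · rfl
      · rw [edgesBetween_comm]
    have hinj {a b : ℕ} (ha : a < n) (hb : b < n) (hab : f a = f b) : a = b :=
      hf.injOn ha hb hab
    have hne : s(f i, f j) ≠ s(f 0, f 1) := fun h => hij <| by
      obtain ⟨h0, h1⟩ | ⟨h0, h1⟩ := Sym2.eq_iff.1 h
      · rw [hinj hi (by lia) h0, hinj hj (by lia) h1]
      · rw [hinj hi (by lia) h0, hinj hj (by lia) h1, Sym2.eq_swap]
    rw [edgesBetween_withBundle hi hj hij]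
    obtain hempty | ⟨e, he⟩ := (hB.subsingleton_edgesBetween hne).eq_empty_or_singleton
    · have hS' : s(i, j) ∉ S := fun h => by
        obtain ⟨e, he⟩ := (hadj i j hle hj hij).2 h
        exact hempty.subset he
      simp [hempty, hS']
    · have hS' : s(i, j) ∈ S :=
        (hadj i j hle hj hij).1 ⟨e, (he.symm.subset rfl : e ∈ G.edgesBetween (f i) (f j))⟩
      simp [he, hS']
  let φ : (withBundle n (G.edgesBetween (f 0) (f 1)).ncard S).vertexSet ≃ G.vertexSet :=
    hf.equiv f
  refine isomorphic_of_ncard_edgesBetween hE (finite_edgeSet_withBundle n _ S) φ.symm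
    fun x y => ?_
  obtain ⟨i, rfl⟩ := φ.surjective x
  obtain ⟨j, rfl⟩ := φ.surjective y
  rw [Equiv.symm_apply_apply, Equiv.symm_apply_apply]
  exact hncard i j i.2 j.2

theorem isomorphic_withBundle_or [G.Loopless] (hE : G.edgeSet.Finite) (hn : 2 ≤ n)
    (hf : Set.BijOn f {v | v < n} G.vertexSet) (hB : IsOnlyBundle G (f 0) (f 1))
    (hS : ∀ i j, i ≤ j → s(i, j) ∈ S → 1 ≤ i ∧ i < j)
    (hadj : ∀ i j, i < j → j < n → (i = 0 → 3 ≤ j) → (G.Adj (f i) (f j) ↔ s(i, j) ∈ S)) :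
    G.Isomorphic (withBundle n (G.edgesBetween (f 0) (f 1)).ncard S) ∨ 3 ≤ n ∧
      G.Isomorphic (withBundle n (G.edgesBetween (f 0) (f 1)).ncard (S ∪ {s(0, 2)})) := by
  have h01 : s(0, 1) ∉ S := fun h => by simpa using (hS 0 1 zero_le_one h).1
  have h02 : s(0, 2) ∉ S := fun h => by simpa using (hS 0 2 zero_le_two h).1
  have hloop (i : ℕ) : ¬ G.Adj (f i) (f i) ∧ s(i, i) ∉ S :=
    ⟨fun ⟨e, he⟩ => he.ne rfl, fun h => (hS i i le_rfl h).2.false⟩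
  have hcase {i j : ℕ} (hij : i ≤ j) (hne : s(i, j) ≠ s(0, 1)) :
      i = j ∨ (i = 0 ∧ j = 2) ∨ (i < j ∧ (i = 0 → 3 ≤ j) ∧ s(i, j) ≠ s(0, 2)) := by
    have : ¬ (i = 0 ∧ j = 1) := by rintro ⟨rfl, rfl⟩; exact hne rfl
    by_cases h : i = 0 ∧ j = 2
    · exact .inr (.inl h)
    · grind [Sym2.eq_iff]
  by_cases h2 : 2 < n ∧ G.Adj (f 0) (f 2)
  · refine .inr ⟨h2.1, isomorphic_withBundle hE hn hf hB (by simp [h01]) fun i j hij hj hne => ?_⟩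
    obtain rfl | ⟨rfl, rfl⟩ | ⟨hlt, h3, hne'⟩ := hcase hij hne
    · simp only [(hloop i).1, false_iff]
      simp [(hloop i).2]
      lia
    · simp [h2]
    · simp [hadj i j hlt hj h3, hne']
  · refine .inl (isomorphic_withBundle hE hn hf hB h01 fun i j hij hj hne => ?_)
    obtain rfl | ⟨rfl, rfl⟩ | ⟨hlt, h3, -⟩ := hcase hij hne
    · simp [(hloop i).1, (hloop i).2]
    · exact iff_of_false (fun h => h2 ⟨hj, h⟩) h02
    · exact hadj i j hlt hj h3

end WithBundle

section Path

variable {α β : Type*} {G : Graph α β} {x y q r : α} {j k : ℕ} {f g : ℕ → α}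

/-! ### Growing a path from the bundle -/

theorem vertexSet_subset_of_closed {W : Set α} (hG : Preconnected G) (hx : x ∈ G.vertexSet)
    (hxW : x ∈ W) (hW : ∀ v ∈ W, ∀ z, G.Adj v z → z ∈ W) : G.vertexSet ⊆ W := by
  intro v hv
  induction hG x hx v hv with
  | refl => exact hxW
  | tail _ hadj ih => exact hW _ (ih hadj.left_mem) _ hadj

theorem connOn_image_Icc (hf : ∀ i, 1 ≤ i → i < k → G.Adj (f i) (f (i + 1))) (hj : 1 ≤ j) :
    ConnOn G (f '' Set.Icc j k) := by
  induction k with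
  | zero => simpa [Set.Icc_eq_empty_of_lt (Nat.lt_of_succ_le hj)] using connOn_empty G
  | succ k ih =>
    have hconn := ih fun i hi hik => hf i hi (by lia)
    obtain hjk | rfl | hjk : k + 1 < j ∨ j = k + 1 ∨ j ≤ k := by lia
    · simpa [hjk] using connOn_empty G
    · simpa using connOn_singleton G _
    · rw [← Set.insert_Icc_right_eq_Icc_add_one (by lia), Set.image_insert_eq]
      exact hconn.insert (Set.mem_image_of_mem f ⟨hjk, le_rfl⟩) (hf k (by lia) (by lia))

theorem connOn_image_Icc_union_pair (hk : 1 ≤ k)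
    (hf : ∀ i, 1 ≤ i → i < k → G.Adj (f i) (f (i + 1)))
    (hq : ∃ i ∈ Set.Icc 1 k, G.Adj (f i) q) : ConnOn G (f '' Set.Icc 2 k ∪ {f 1, q}) := by
  obtain ⟨i, hi, hadj⟩ := hq
  have hset : insert (f 1) (f '' Set.Icc 2 k) = f '' Set.Icc 1 k :=
    Set.image_insert_eq.symm.trans (congrArg (f '' ·) (Set.insert_Icc_add_one_left_eq_Icc hk))
  rw [Set.union_comm, Set.pair_comm, Set.insert_union, Set.singleton_union, hset]
  exact (connOn_image_Icc hf le_rfl).insert (Set.mem_image_of_mem f hi) hadj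

theorem not_inGStar_of_path (hV : G.vertexSet.Finite) (hE : G.edgeSet.Finite) (hk : Odd k)
    (hinj : Set.InjOn f (Set.Iic k)) (hf : ∀ i, 1 ≤ i → i < k → G.Adj (f i) (f (i + 1)))
    (hB : (G.edgesBetween (f 0) (f 1)).Nontrivial) (hqr : q ≠ r) (hq : q ∉ f '' Set.Iic k)
    (hr : r ∉ f '' Set.Iic k) (hqadj : ∃ i ∈ Set.Icc 1 k, G.Adj (f i) q)
    (hradj : ∃ i ∈ Set.Icc 1 k, G.Adj (f i) r) : ¬ G.InGStar := by
  have hk1 : 1 ≤ k := hk.pos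
  have hmem {i : ℕ} (hi : i ≤ k) : f i ∈ f '' Set.Iic k := Set.mem_image_of_mem f hi
  have hsubC : f '' Set.Icc 2 k ⊆ f '' Set.Iic k := Set.image_mono Set.Icc_subset_Iic_self
  have hC {i : ℕ} (hi : i < 2) (hik : i ≤ k) : f i ∉ f '' Set.Icc 2 k := by
    rw [hinj.mem_image_iff Set.Icc_subset_Iic_self hik]
    exact fun h => hi.not_ge h.1
  have h01 : f 0 ≠ f 1 := fun h => zero_ne_one (hinj (Nat.zero_le k) hk1 h)
  obtain ⟨a, ha, b, hb, hab⟩ := hB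
  have hbranch : IsBranching G (f '' Set.Icc 2 k) (f 0) (f 1) q r a b :=
    { subset := by
        rintro z (⟨i, hi, rfl⟩ | rfl | rfl | rfl | rfl)
        · obtain ⟨i, rfl⟩ := Nat.exists_eq_add_of_le' (one_le_two.trans hi.1)
          exact (hf i (Nat.le_of_succ_le_succ hi.1) hi.2).right_mem
        exacts [IsLink.left_mem ha, IsLink.right_mem ha, hqadj.choose_spec.2.right_mem,
          hradj.choose_spec.2.right_mem]
      nodup := by
        have hne {z : α} (hz : z ∉ f '' Set.Iic k) : f 0 ≠ z ∧ f 1 ≠ z :=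
          ⟨ne_of_mem_of_not_mem (hmem k.zero_le) hz, ne_of_mem_of_not_mem (hmem hk1) hz⟩
        simp [h01, hne hq, hne hr, hqr]
      disjoint := by
        simp only [Set.disjoint_insert_right, Set.disjoint_singleton_right]
        exact ⟨hC two_pos k.zero_le, hC one_lt_two hk1, fun h => hq (hsubC h),
          fun h => hr (hsubC h)⟩
      ne := hab
      isLink_left := ha
      isLink_right := hb
      even := by
        rw [Set.InjOn.ncard_image (hinj.mono Set.Icc_subset_Iic_self),
          Set.ncard_eq_toFinset_card', Set.toFinset_Icc, Nat.card_Icc]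
        exact (Nat.even_sub (Nat.succ_le_succ hk1)).2 (iff_of_true hk.add_one even_two)
      connOn := connOn_image_Icc hf one_le_two
      connOn_left := .inr (connOn_image_Icc_union_pair hk1 hf hqadj)
      connOn_right := .inr (connOn_image_Icc_union_pair hk1 hf hradj) }
  exact hbranch.not_inGStar hV hE

theorem eq_of_adj_pair (hG : G.InGStar) (hV : G.vertexSet.Finite) (hE : G.edgeSet.Finite)
    (hxy : x ≠ y) (hB : (G.edgesBetween x y).Nontrivial) (hq : q ∉ ({x, y} : Set α))
    (hr : r ∉ ({x, y} : Set α)) (hqadj : G.Adj x q ∨ G.Adj y q)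
    (hradj : G.Adj x r ∨ G.Adj y r) : q = r := by
  by_contra hqr
  obtain ⟨a, ha, b, hb, hab⟩ := hB
  simp only [Set.mem_insert_iff, Set.mem_singleton_iff, not_or] at hq hr
  have hpair {z : α} (hz : G.Adj x z ∨ G.Adj y z) : z ∈ G.vertexSet ∧
      (ConnOn G (∅ ∪ {x, z}) ∨ ConnOn G (∅ ∪ {y, z})) := by
    simp only [Set.empty_union]
    exact ⟨hz.elim Adj.right_mem Adj.right_mem, hz.imp connOn_pair connOn_pair⟩
  have hbranch : IsBranching G ∅ x y q r a b :=
    { subset := by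
        rw [Set.empty_union]
        rintro z (rfl | rfl | rfl | rfl)
        exacts [IsLink.left_mem ha, IsLink.right_mem ha, (hpair hqadj).1, (hpair hradj).1]
      nodup := by simp [hxy, hqr, Ne.symm hq.1, Ne.symm hq.2, Ne.symm hr.1, Ne.symm hr.2]
      disjoint := Set.empty_disjoint _
      ne := hab
      isLink_left := ha
      isLink_right := hb
      even := by simp
      connOn := connOn_empty G
      connOn_left := (hpair hqadj).2
      connOn_right := (hpair hradj).2 }
  exact hbranch.not_inGStar hV hE hG

end Path

section Trunk

variable {α β : Type*} {G : Graph α β} {i j k n : ℕ} {f g : ℕ → α}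

/-- The graph `G` is one of the graphs `tildeP`, `tildeS`, `tildeT`, `tildeP'`, `tildeS'`, `tildeT'`
with a bundle of size `m`. -/
def IsTilde (G : Graph α β) (m : ℕ) : Prop :=
  ∃ n, (2 ≤ n ∧ G.Isomorphic (tildeP n m)) ∨ (5 ≤ n ∧ Odd n ∧ G.Isomorphic (tildeS n m)) ∨
    (5 ≤ n ∧ Odd n ∧ G.Isomorphic (tildeT n m)) ∨ (3 ≤ n ∧ G.Isomorphic (tildeP' n m)) ∨
    (5 ≤ n ∧ Odd n ∧ G.Isomorphic (tildeS' n m)) ∨ (5 ≤ n ∧ Odd n ∧ G.Isomorphic (tildeT' n m))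

/-- The vertices `f 0, …, f k` are distinct, `f 1, …, f k` induce a path, no edge joins `f 0` to
`f 3, …, f k`, and no vertex outside is adjacent to one of `f 0, …, f (k - 1)`. The edges between
`f 0` and `f 1` or `f 2` are left open. -/
structure IsTrunk (G : Graph α β) (k : ℕ) (f : ℕ → α) : Prop where
  pos : 1 ≤ k
  mem : ∀ i ≤ k, f i ∈ G.vertexSet
  injOn : Set.InjOn f (Set.Iic k)
  adj_iff : ∀ i j, i < j → j ≤ k → (i = 0 → 3 ≤ j) → (G.Adj (f i) (f j) ↔ j = i + 1)
  not_adj : ∀ z ∉ f '' Set.Iic k, ∀ i < k, ¬ G.Adj (f i) z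

theorem mk_mem_pathEdges (hij : i < j) : s(i, j) ∈ pathEdges k ↔ 1 ≤ i ∧ j ≤ k ∧ j = i + 1 := by
  refine ⟨?_, fun ⟨hi, hj, h⟩ => ⟨i, hi, h ▸ hj, h ▸ rfl⟩⟩
  rintro ⟨l, hl, hlk, h⟩
  obtain ⟨rfl, rfl⟩ | ⟨rfl, rfl⟩ := Sym2.eq_iff.1 h
  · exact ⟨hl, hlk, rfl⟩
  · exact absurd hij (Nat.lt_succ_self _).not_gt

theorem pos_and_lt_of_mem_pathEdges (hij : i ≤ j) (h : s(i, j) ∈ pathEdges k) :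
    1 ≤ i ∧ i < j := by
  obtain ⟨l, hl, -, h⟩ := h
  obtain ⟨rfl, rfl⟩ | ⟨rfl, rfl⟩ := Sym2.eq_iff.1 h
  · exact ⟨hl, Nat.lt_succ_self _⟩
  · exact absurd hij (Nat.lt_succ_self _).not_ge

theorem image_Iic_add_one : f '' Set.Iic (k + 1) = insert (f (k + 1)) (f '' Set.Iic k) := by
  rw [← Set.image_insert_eq]
  exact congrArg (f '' ·) (Order.Iic_succ k)

theorem injOn_Iic_add_one :
    Set.InjOn f (Set.Iic (k + 1)) ↔ Set.InjOn f (Set.Iic k) ∧ f (k + 1) ∉ f '' Set.Iic k := by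
  rw [← Set.injOn_insert (by simp)]
  exact iff_of_eq (congrArg (Set.InjOn f) (Order.Iic_succ k))

theorem injOn_Iic_one : Set.InjOn f (Set.Iic 1) ↔ f 0 ≠ f 1 := by
  refine ⟨fun h heq => zero_ne_one (h (Set.mem_Iic.2 zero_le_one) Set.self_mem_Iic heq),
    fun h i hi j hj hij => ?_⟩
  obtain rfl | rfl := Nat.le_one_iff_eq_zero_or_eq_one.1 hi <;>
    obtain rfl | rfl := Nat.le_one_iff_eq_zero_or_eq_one.1 hj
  exacts [rfl, absurd hij h, absurd hij.symm h, rfl]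

theorem exists_eqOn_Iic (f : ℕ → α) (k : ℕ) (x : α) :
    ∃ g, Set.EqOn f g (Set.Iic k) ∧ g (k + 1) = x :=
  ⟨Function.update f (k + 1) x,
    fun _ hi => (Function.update_of_ne (Nat.lt_succ_of_le hi).ne _ _).symm,
    Function.update_self ..⟩

namespace IsTrunk

theorem congr (h : IsTrunk G k f) (hfg : Set.EqOn f g (Set.Iic k)) : IsTrunk G k g where
  pos := h.pos
  mem i hi := hfg hi ▸ h.mem i hi
  injOn := h.injOn.congr hfg
  adj_iff i j hij hj h3 := by
    rw [← hfg hj, ← hfg (hij.le.trans hj)]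
    exact h.adj_iff i j hij hj h3
  not_adj z hz i hi := by
    rw [← hfg.image_eq] at hz
    rw [← hfg hi.le]
    exact h.not_adj z hz i hi

theorem adj_succ (h : IsTrunk G k f) (hi : 1 ≤ i) (hik : i < k) : G.Adj (f i) (f (i + 1)) :=
  (h.adj_iff i (i + 1) i.lt_succ_self hik (by lia)).2 rfl

theorem lt_ncard (h : IsTrunk G k f) (hV : G.vertexSet.Finite) : k < G.vertexSet.ncard := by
  have hsub : f '' Set.Iic k ⊆ G.vertexSet := Set.image_subset_iff.2 h.mem
  have hcard := Set.ncard_le_ncard hsub hV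
  rw [h.injOn.ncard_image, Set.ncard_eq_toFinset_card', Set.toFinset_Iic, Nat.card_Iic] at hcard
  exact hcard

theorem extend (h : IsTrunk G k f) (hk : f (k + 1) ∉ f '' Set.Iic k)
    (hadj : G.Adj (f k) (f (k + 1)))
    (hclosed : ∀ z ∉ f '' Set.Iic (k + 1), ¬ G.Adj (f k) z) : IsTrunk G (k + 1) f where
  pos := h.pos.trans k.le_succ
  mem i hi := by
    obtain rfl | hi := Nat.le_succ_iff_eq_or_le.1 hi
    · exact hadj.right_mem
    · exact h.mem i hi
  injOn := injOn_Iic_add_one.2 ⟨h.injOn, hk⟩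
  adj_iff i j hij hj h3 := by
    obtain rfl | hj := Nat.le_succ_iff_eq_or_le.1 hj
    · obtain hik | rfl := Nat.lt_succ_iff_lt_or_eq.1 hij
      · exact iff_of_false (h.not_adj _ hk i hik) (by lia)
      · exact iff_of_true hadj rfl
    · exact h.adj_iff i j hij hj h3
  not_adj z hz i hi := by
    obtain hik | rfl := Nat.lt_succ_iff_lt_or_eq.1 hi
    · exact h.not_adj z (fun hz' => hz (Set.image_mono (Set.Iic_subset_Iic.2 k.le_succ) hz')) i hik
    · exact hclosed z hz

theorem bijOn_of_closed {l : ℕ} (h : IsTrunk G k f) (hG : Preconnected G) (hkl : k ≤ l)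
    (hmem : ∀ i ≤ l, f i ∈ G.vertexSet) (hinj : Set.InjOn f (Set.Iic l))
    (hclosed : ∀ z ∉ f '' Set.Iic l, ∀ i, k ≤ i → i ≤ l → ¬ G.Adj (f i) z) :
    Set.BijOn f {v | v < l + 1} G.vertexSet := by
  have hset : {v | v < l + 1} = Set.Iic l := Set.ext fun _ => Nat.lt_succ_iff
  rw [hset]
  refine ⟨hmem, hinj, vertexSet_subset_of_closed hG (h.mem 0 k.zero_le)
    (Set.mem_image_of_mem f l.zero_le) ?_⟩
  rintro _ ⟨i, hi, rfl⟩ z hadj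
  by_contra hz
  obtain hik | hki := Nat.lt_or_ge i k
  · have hsub : f '' Set.Iic k ⊆ f '' Set.Iic l := Set.image_mono (Set.Iic_subset_Iic.2 hkl)
    exact h.not_adj z (fun hz' => hz (hsub hz')) i hik hadj
  · exact hclosed z hz i hki hi hadj

theorem isTilde_of_closed [G.Loopless] (h : IsTrunk G k f) (hE : G.edgeSet.Finite)
    (hG : Preconnected G) (hB : IsOnlyBundle G (f 0) (f 1))
    (hclosed : ∀ z ∉ f '' Set.Iic k, ¬ G.Adj (f k) z) :
    IsTilde G (G.edgesBetween (f 0) (f 1)).ncard := by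
  have hbij := h.bijOn_of_closed hG le_rfl h.mem h.injOn fun z hz i hki hik =>
    le_antisymm hki hik ▸ hclosed z hz
  obtain hiso | ⟨hn, hiso⟩ := isomorphic_withBundle_or (S := pathEdges k) hE
    (Nat.succ_le_succ h.pos) hbij hB
    (fun i j => pos_and_lt_of_mem_pathEdges)
    (fun i j hij hj h3 => by
      rw [h.adj_iff i j hij (Nat.le_of_lt_succ hj) h3, mk_mem_pathEdges hij]
      lia)
  · exact ⟨k + 1, .inl ⟨Nat.succ_le_succ h.pos, hiso⟩⟩
  · exact ⟨k + 1, .inr (.inr (.inr (.inl ⟨hn, hiso⟩)))⟩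

theorem adj_iff_of_fork (h : IsTrunk G k f) (hinj : Set.InjOn f (Set.Iic (k + 2)))
    (hp : G.Adj (f k) (f (k + 1))) (hq : G.Adj (f k) (f (k + 2))) (hij : i < j) (hj : j ≤ k + 2)
    (h3 : i = 0 → 3 ≤ j) (hne : i ≠ k + 1) :
    G.Adj (f i) (f j) ↔ (j = i + 1 ∧ j ≤ k + 1) ∨ (i = k ∧ j = k + 2) := by
  obtain hjk | hkj := le_or_gt j k
  · rw [h.adj_iff i j hij hjk h3]
    lia
  obtain rfl | hik : i = k ∨ i < k := by lia
  · obtain rfl | rfl : j = i + 1 ∨ j = i + 2 := by lia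
    · exact iff_of_true hp (by lia)
    · exact iff_of_true hq (by lia)
  · refine iff_of_false (h.not_adj _ (fun hmem => ?_) i hik) (by lia)
    have := (hinj.mem_image_iff (Set.Iic_subset_Iic.2 (k.le_add_right 2)) hj).1 hmem
    exact hkj.not_ge this

theorem isTilde_of_fork [G.Loopless] (h : IsTrunk G k f) (hE : G.edgeSet.Finite)
    (hB : IsOnlyBundle G (f 0) (f 1)) (hk : Even k)
    (hbij : Set.BijOn f {v | v < k + 3} G.vertexSet) (hp : G.Adj (f k) (f (k + 1)))
    (hq : G.Adj (f k) (f (k + 2))) : IsTilde G (G.edgesBetween (f 0) (f 1)).ncard := by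
  have hk2 : 2 ≤ k := Nat.le_of_dvd h.pos hk.two_dvd
  have hodd : Odd (k + 3) := hk.add_odd (by decide)
  have hinj : Set.InjOn f (Set.Iic (k + 2)) := fun i hi j hj hij =>
    hbij.injOn (Nat.lt_succ_of_le hi) (Nat.lt_succ_of_le hj) hij
  have hiso {T : Set (Sym2 ℕ)} (hT : ∀ i j, i ≤ j → (s(i, j) ∈ T ↔
      j = k + 2 ∧ (i = k ∨ i = k + 1 ∧ G.Adj (f (k + 1)) (f (k + 2))))) :=
    isomorphic_withBundle_or (S := pathEdges (k + 1) ∪ T) hE (by lia) hbij hB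
      (fun i j hij hmem => hmem.elim (pos_and_lt_of_mem_pathEdges hij) fun hmem => by
        have := (hT i j hij).1 hmem
        lia)
      (fun i j hij hj h3 => by
        rw [Set.mem_union, mk_mem_pathEdges hij, hT i j hij.le]
        by_cases hi : i = k + 1
        · obtain rfl : j = k + 2 := by lia
          simp [hi]
        · rw [h.adj_iff_of_fork hinj hp hq hij (by lia) h3 hi]
          lia)
  by_cases hpq : G.Adj (f (k + 1)) (f (k + 2))
  · obtain hiso | ⟨-, hiso⟩ := hiso (T := {s(k, k + 2), s(k + 1, k + 2)}) fun i j hij => by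
      simp only [Set.mem_insert_iff, Set.mem_singleton_iff, Sym2.eq_iff, hpq]
      lia
    · exact ⟨k + 3, .inr (.inr (.inl ⟨by lia, hodd, hiso⟩))⟩
    · exact ⟨k + 3, .inr (.inr (.inr (.inr (.inr ⟨by lia, hodd, hiso⟩))))⟩
  · obtain hiso | ⟨-, hiso⟩ := hiso (T := {s(k, k + 2)}) fun i j hij => by
      simp only [Set.mem_singleton_iff, Sym2.eq_iff, hpq]
      lia
    · exact ⟨k + 3, .inr (.inl ⟨by lia, hodd, hiso⟩)⟩
    · exact ⟨k + 3, .inr (.inr (.inr (.inr (.inl ⟨by lia, hodd, hiso⟩))))⟩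

theorem not_inGStar_of_fork {p q r : α} (h : IsTrunk G k f) (hV : G.vertexSet.Finite)
    (hE : G.edgeSet.Finite) (hB : (G.edgesBetween (f 0) (f 1)).Nontrivial) (hk : Even k)
    (hp : p ∉ f '' Set.Iic k) (hq : q ∉ f '' Set.Iic k) (hr : r ∉ f '' Set.Iic k) (hpq : p ≠ q)
    (hpr : p ≠ r) (hqr : q ≠ r) (hkp : G.Adj (f k) p) (hkq : G.Adj (f k) q)
    (hkr : G.Adj (f k) r ∨ G.Adj p r) : ¬ G.InGStar := by
  obtain ⟨g, hfg, rfl⟩ := exists_eqOn_Iic f k p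
  have hk1 := h.pos
  have hg := h.congr hfg
  rw [hfg.image_eq] at hp hq hr
  rw [hfg k.zero_le, hfg hk1] at hB
  rw [hfg Set.self_mem_Iic] at hkp hkq hkr
  refine not_inGStar_of_path hV hE hk.add_one (injOn_Iic_add_one.2 ⟨hg.injOn, hp⟩)
    (fun i hi hik => ?_) hB hqr ?_ ?_ ⟨k, ⟨hk1, k.le_succ⟩, hkq⟩ ?_
  · obtain hik | rfl := Nat.lt_succ_iff_lt_or_eq.1 hik
    exacts [hg.adj_succ hi hik, hkp]
  · simpa [image_Iic_add_one, hpq.symm] using hq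
  · simpa [image_Iic_add_one, hpr.symm] using hr
  · exact hkr.elim (fun hkr => ⟨k, ⟨hk1, k.le_succ⟩, hkr⟩)
      fun hpr => ⟨k + 1, ⟨Nat.le_add_left 1 k, le_rfl⟩, hpr⟩

theorem isTilde_of_adj_adj [G.Loopless] (h : IsTrunk G k f) (hG : G.InGStar)
    (hV : G.vertexSet.Finite) (hE : G.edgeSet.Finite) (hconn : Preconnected G)
    (hB : IsOnlyBundle G (f 0) (f 1)) (hinj : Set.InjOn f (Set.Iic (k + 2)))
    (hp : G.Adj (f k) (f (k + 1))) (hq : G.Adj (f k) (f (k + 2))) :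
    IsTilde G (G.edgesBetween (f 0) (f 1)).ncard := by
  obtain ⟨hinj', hqmem⟩ := injOn_Iic_add_one.1 hinj
  have hpmem := (injOn_Iic_add_one.1 hinj').2
  rw [image_Iic_add_one, Set.mem_insert_iff, not_or] at hqmem
  obtain ⟨hqp : f (k + 2) ≠ f (k + 1), hqmem⟩ := hqmem
  have hk : Even k := by
    by_contra hk
    rw [Nat.not_even_iff_odd] at hk
    exact not_inGStar_of_path hV hE hk h.injOn (fun i => h.adj_succ) hB.1 hqp.symm hpmem hqmem
      ⟨k, ⟨h.pos, le_rfl⟩, hp⟩ ⟨k, ⟨h.pos, le_rfl⟩, hq⟩ hG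
  refine h.isTilde_of_fork hE hB hk (h.bijOn_of_closed hconn (k.le_add_right 2) ?_ hinj ?_) hp hq
  · intro i hi
    obtain hik | rfl | rfl : i ≤ k ∨ i = k + 1 ∨ i = k + 2 := by lia
    exacts [h.mem i hik, hp.right_mem, hq.right_mem]
  · intro z hz i hki hi hadj
    rw [image_Iic_add_one, image_Iic_add_one, Set.mem_insert_iff, Set.mem_insert_iff, not_or,
      not_or] at hz
    obtain ⟨hzq : z ≠ _, hzp : z ≠ _, hz⟩ := hz
    obtain rfl | rfl | rfl : i = k ∨ i = k + 1 ∨ i = k + 2 := by lia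
    · exact h.not_inGStar_of_fork hV hE hB.1 hk hpmem hqmem hz hqp.symm hzp.symm hzq.symm hp hq
        (.inl hadj) hG
    · exact h.not_inGStar_of_fork hV hE hB.1 hk hpmem hqmem hz hqp.symm hzp.symm hzq.symm hp hq
        (.inr hadj) hG
    · exact h.not_inGStar_of_fork hV hE hB.1 hk hqmem hpmem hz hqp hzq.symm hzp.symm hq hp
        (.inr hadj) hG

theorem isTilde [G.Loopless] {k : ℕ} {f : ℕ → α} (h : IsTrunk G k f) (hG : G.InGStar)
    (hV : G.vertexSet.Finite) (hE : G.edgeSet.Finite) (hconn : Preconnected G)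
    (hB : IsOnlyBundle G (f 0) (f 1)) : IsTilde G (G.edgesBetween (f 0) (f 1)).ncard := by
  by_cases hend : ∀ z ∉ f '' Set.Iic k, ¬ G.Adj (f k) z
  · exact h.isTilde_of_closed hE hconn hB hend
  push Not at hend
  obtain ⟨p, hp, hkp⟩ := hend
  obtain ⟨g, hfg, rfl⟩ := exists_eqOn_Iic f k p
  have hg := h.congr hfg
  rw [hfg Set.self_mem_Iic] at hkp
  rw [hfg.image_eq] at hp
  rw [hfg k.zero_le, hfg h.pos] at hB ⊢
  by_cases hnext : ∀ z ∉ g '' Set.Iic (k + 1), ¬ G.Adj (g k) z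
  · have := h.lt_ncard hV
    exact (hg.extend hp hkp hnext).isTilde hG hV hE hconn hB
  push Not at hnext
  obtain ⟨q, hq, hkq⟩ := hnext
  obtain ⟨g', hgg', rfl⟩ := exists_eqOn_Iic g (k + 1) q
  have hgg'_k : Set.EqOn g g' (Set.Iic k) := hgg'.mono (Set.Iic_subset_Iic.2 k.le_succ)
  rw [hgg'_k Set.self_mem_Iic] at hkp hkq
  rw [hgg' Set.self_mem_Iic] at hkp
  rw [hgg'_k k.zero_le, hgg'_k h.pos] at hB ⊢
  exact (hg.congr hgg'_k).isTilde_of_adj_adj hG hV hE hconn hB (injOn_Iic_add_one.2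
    ⟨(injOn_Iic_add_one.2 ⟨hg.injOn, hp⟩).congr hgg', hgg'.image_eq ▸ hq⟩) hkp hkq
termination_by G.vertexSet.ncard - k

end IsTrunk

theorem IsOnlyBundle.symm {x y : α} (h : IsOnlyBundle G x y) : IsOnlyBundle G y x :=
  ⟨edgesBetween_comm G x y ▸ h.1, fun u v huv => (h.2 u v huv).trans Sym2.eq_swap⟩

theorem isTrunk_one (h0 : f 0 ∈ G.vertexSet) (h1 : f 1 ∈ G.vertexSet) (hne : f 0 ≠ f 1)
    (hclosed : ∀ z ∉ ({f 0, f 1} : Set α), ¬ G.Adj (f 0) z) : IsTrunk G 1 f where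
  pos := le_rfl
  mem i hi := by
    obtain rfl | rfl := Nat.le_one_iff_eq_zero_or_eq_one.1 hi
    exacts [h0, h1]
  injOn := injOn_Iic_one.2 hne
  adj_iff i j hij hj h3 := by lia
  not_adj z hz i hi := by
    obtain rfl := Nat.lt_one_iff.1 hi
    refine hclosed z ?_
    rintro (rfl | rfl)
    exacts [hz ⟨0, by simp, rfl⟩, hz ⟨1, by simp, rfl⟩]

theorem isTrunk_two (h0 : f 0 ∈ G.vertexSet) (hinj : Set.InjOn f (Set.Iic 2))
    (hadj : G.Adj (f 1) (f 2))
    (hclosed : ∀ z ∉ ({f 0, f 1, f 2} : Set α), ¬ (G.Adj (f 0) z ∨ G.Adj (f 1) z)) :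
    IsTrunk G 2 f where
  pos := one_le_two
  mem i hi := by
    interval_cases i
    exacts [h0, hadj.left_mem, hadj.right_mem]
  injOn := hinj
  adj_iff i j hij hj h3 := by
    obtain ⟨rfl, rfl⟩ : i = 1 ∧ j = 2 := by lia
    exact iff_of_true hadj rfl
  not_adj z hz i hi hiz := by
    refine hclosed z ?_ ?_
    · rintro (rfl | rfl | rfl)
      exacts [hz ⟨0, by simp, rfl⟩, hz ⟨1, by simp, rfl⟩, hz ⟨2, by simp, rfl⟩]
    · obtain rfl | rfl := Nat.le_one_iff_eq_zero_or_eq_one.1 (Nat.le_of_lt_succ hi)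
      exacts [.inl hiz, .inr hiz]

theorem exists_isTrunk [G.Loopless] (hG : G.InGStar) (hV : G.vertexSet.Finite)
    (hE : G.edgeSet.Finite) {x y : α} (hB : IsOnlyBundle G x y) :
    ∃ k f, IsTrunk G k f ∧ IsOnlyBundle G (f 0) (f 1) := by
  have hxy := ne_of_nontrivial_edgesBetween hB.1
  have ⟨hx, hy⟩ := mem_of_nontrivial_edgesBetween hB.1
  by_cases hend : ∀ z ∉ ({x, y} : Set α), ¬ (G.Adj x z ∨ G.Adj y z)
  · exact ⟨1, fun | 0 => x | _ => y,
      isTrunk_one hx hy hxy fun z hz hadj => hend z hz (.inl hadj), hB⟩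
  push Not at hend
  obtain ⟨w, hw, hadj⟩ := hend
  wlog hyw : G.Adj y w generalizing x y
  · exact this hB.symm hxy.symm hy hx (Set.pair_comm x y ▸ hw) hadj.symm
      (hadj.resolve_right hyw)
  refine ⟨2, fun | 0 => x | 1 => y | _ => w, isTrunk_two hx ?_ hyw ?_, hB⟩
  · refine injOn_Iic_add_one.2 ⟨injOn_Iic_one.2 hxy, ?_⟩
    rintro ⟨i, hi, h⟩
    obtain rfl | rfl := Nat.le_one_iff_eq_zero_or_eq_one.1 hi
    exacts [hw (.inl h.symm), hw (.inr h.symm)]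
  · intro z hz hzadj
    simp only [Set.mem_insert_iff, Set.mem_singleton_iff, not_or] at hz
    exact hz.2.2 (eq_of_adj_pair hG hV hE hxy hB.1 (by simp [hz.1, hz.2.1]) hw hzadj hadj)

theorem exists_nontrivial_edgesBetween [G.Loopless] (hG : ¬ G.Simple) :
    ∃ x y, (G.edgesBetween x y).Nontrivial := by
  by_contra! hcon
  exact hG ⟨fun e f x y he hf => hcon x y he hf⟩

end Trunk

end Multigraph

open Multigraph

theorem theorem4p2 {α β : Type*} (G : Graph α β) (hV : G.vertexSet.Finite)
    (hE : G.edgeSet.Finite) (hloopless : G.Loopless) (hconn : G.IsConnectedGraph)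
    (hnonsimple : ¬ G.Simple) (hG : G.InGStar) :
    ∃ n m : ℕ, 2 ≤ m ∧
      ((2 ≤ n ∧ G.Isomorphic (Graph.tildeP n m)) ∨
        (5 ≤ n ∧ Odd n ∧ G.Isomorphic (Graph.tildeS n m)) ∨
        (5 ≤ n ∧ Odd n ∧ G.Isomorphic (Graph.tildeT n m)) ∨
        (3 ≤ n ∧ G.Isomorphic (Graph.tildeP' n m)) ∨
        (5 ≤ n ∧ Odd n ∧ G.Isomorphic (Graph.tildeS' n m)) ∨
        (5 ≤ n ∧ Odd n ∧ G.Isomorphic (Graph.tildeT' n m))) := by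
  obtain ⟨x, y, hxy⟩ := exists_nontrivial_edgesBetween hnonsimple
  have hB : IsOnlyBundle G x y := isOnlyBundle_of_inGStar hG hV hE hconn.2 hxy
  obtain ⟨k, f, htrunk, hf⟩ := exists_isTrunk hG hV hE hB
  obtain ⟨n, hn⟩ := htrunk.isTilde hG hV hE hconn.2 hf
  have := (finite_edgesBetween hE (f 0) (f 1)).to_subtype
  exact ⟨n, _, Set.one_lt_ncard_iff_nontrivial.2 hf.1, hn⟩
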